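/- **Setting.** Let $\mathbb V^{n_1\times n_2}$ be one of the real vector spaces $\mathbb R^{n_1\times n_2}$, $\mathbb C^{n_1\times n_2}$, or (with $n_1=n_2$) the real symmetric or the Hermitian matrices, with the inner product $\langle X,Y\rangle=\operatorname{Re}\operatorname{Tr}(X^{\mathbb T}Y)$ and the induced norm $\|\cdot\|_F$; here $^{\mathbb T}$ is the transpose (conjugate transpose in the complex case). $\|\cdot\|$ and $\|\cdot\|_*$ denote the spectral and the nuclear norm, and $\sigma(X)$ the vector of the $n=\min(n_1,n_2)$ singular values in nonincreasing order. Let $\Theta_1,\dots,\Theta_d$ be an orthonormal basis of $\mathbb V^{n_1\times n_2}$, let $\alpha\subseteq\{1,\dots,d\}$, let $\beta$ be its complement, and let $\overline X\in\mathbb V^{n_1\times n_2}$ have rank $r\ge 1$. *Observations.* Let $p$ be a probability distribution on $\{1,\dots,d\}$ with $p_k=0$ for $k\in\alpha$ and $p_k>0$ for $k\in\beta$. Let $\omega_1,\omega_2,\dots$ be i.i.d. indices with distribution $p$, let $\xi_1,\xi_2,\dots$ be i.i.d. real random variables with mean $0$ and variance $1$, independent of the indices, let $\nu>0$, and let $y_i=\langle\Theta_{\omega_i},\overline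 X\rangle+\nu\xi_i$. *Spectral operator.* Let $f:\mathbb R^n\to\mathbb R^n$ satisfy $f(x)=Q^{\mathbb T}f(Qx)$ for every $x$ and every signed permutation matrix $Q$, and let $F(X)=U\operatorname{Diag}(f(\sigma(X)))V^{\mathbb T}$, where $X=U\operatorname{Diag}(\sigma(X))V^{\mathbb T}$ is any singular value decomposition with square orthogonal (unitary) $U,V$. Assume that $F:\mathbb V^{n_1\times n_2}\to\mathbb V^{n_1\times n_2}$ is continuous at $\overline X$. *Estimator.* Let $\widetilde X_m$ be random matrices in $\mathbb V^{n_1\times n_2}$ with $\widetilde X_m\to\overline X$ in probability, let $\rho_m>0$ be deterministic and let $\gamma_m\ge0$ be random variables. Let $\widehat X_m$ be random matrices such that, for each $m$, almost surely $\widehat X_m$ is an optimal solution, whenever one exists, of $$\min_{X\in\mathbb V^{n_1\times n_2}}\ \frac1{2m}\sum_{i=1}^m\big(y_i-\langle\Theta_{\omega_i},X\rangle\big)^2+\rho_m\Big(\|X\|_*-\langle F(\widetilde X_m),X\rangle+\frac{\gamma_m}2\|X-\widetilde X_m\|_F^2\Big)\quad\text{s.t. } \langle\Theta_k,X\rangle=\langle\Theta_k,\overline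 X\rangle\ \ \forall k\in\alpha.$$ *Linear system.* Let $\overline X=\overline U\operatorname{Diag}(\sigma(\overline X))\overline V^{\mathbb T}$ be a singular value decomposition with square orthogonal (unitary) $\overline U,\overline V$; in the symmetric and Hermitian cases take $\overline U=P$ and $\overline V=P\operatorname{Diag}(s)$, where $\overline X=P\operatorname{Diag}(\lambda)P^{\mathbb T}$ with $P$ orthogonal (unitary), $|\lambda_1|\ge\dots\ge|\lambda_n|$, and $s_i=-1$ if $\lambda_i<0$, $s_i=1$ otherwise. Write $\overline U=[\overline U_1\ \overline U_2]$ and $\overline V=[\overline V_1\ \overline V_2]$, where $\overline U_1,\overline V_1$ consist of the first $r$ columns, and put $\mathcal Q_\beta^\dagger(X)=\sum_{k\in\beta}p_k^{-1}\langle\Theta_k,X\rangle\Theta_k$. **Theorem.** Suppose that $\rho_m\to0$, $\sqrt m\,\rho_m\to\infty$ and $\gamma_m=O_p(1)$ as $m\to\infty$. If the linear system $$\overline U_2^{\mathbb T}\mathcal Q_\beta^\dagger(\overline U_2\Gamma\overline V_2^{\mathbb T})\overline V_2=\overline U_2^{\mathbb T}\mathcal Q_\beta^\dagger\big(\overline U_1\overline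 V_1^{\mathbb T}-F(\overline X)\big)\overline V_2$$ has a unique solution $\widehat\Gamma\in\mathbb V^{(n_1-r)\times(n_2-r)}$, and $\|\widehat\Gamma\|<1$, then $\widehat X_m$ is rank consistent: $\lim_{m\to\infty}\Pr\big(\operatorname{rank}(\widehat X_m)=\operatorname{rank}(\overline X)\big)=1$. -/

import Mathlib

open MeasureTheory ProbabilityTheory Filter Topology Matrix

noncomputable section

namespace RankCorrection

variable {𝕜 : Type*} [RCLike 𝕜]

/-! ### Matrix spaces -/

/-- The shape of the matrix space under consideration: all `n₁ × n₂` matrices, or the self-adjoint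
`n × n` matrices. Over `𝕜 = ℝ` and `𝕜 = ℂ` this gives the four spaces of real, complex,
real symmetric and Hermitian matrices. -/
inductive MatrixKind : ℕ → ℕ → Type
  | full (n₁ n₂ : ℕ) : MatrixKind n₁ n₂
  | hermitian (n : ℕ) : MatrixKind n n

/-- The real vector space `𝕍^{n₁ × n₂}` of matrices of the given kind. -/
def MatrixKind.space (𝕜 : Type*) [RCLike 𝕜] :
    {n₁ n₂ : ℕ} → MatrixKind n₁ n₂ → Submodule ℝ (Matrix (Fin n₁) (Fin n₂) 𝕜)
  | _, _, .full _ _ => ⊤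
  | _, _, .hermitian n => selfAdjoint.submodule ℝ (Matrix (Fin n) (Fin n) 𝕜)

/-- The kind of the space `𝕍^{(n₁ - r) × (n₂ - r)}` that goes with `𝕍^{n₁ × n₂}`. -/
def MatrixKind.corner : {n₁ n₂ : ℕ} → MatrixKind n₁ n₂ → (r : ℕ) → MatrixKind (n₁ - r) (n₂ - r)
  | _, _, .full n₁ n₂, r => .full (n₁ - r) (n₂ - r)
  | _, _, .hermitian n, r => .hermitian (n - r)

/-- The real trace inner product `Re Tr (Xᴴ Y)`. -/
def frobInner {n₁ n₂ : ℕ} (X Y : Matrix (Fin n₁) (Fin n₂) 𝕜) : ℝ :=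
  RCLike.re (Xᴴ * Y).trace

/-- The Frobenius norm. -/
def frobNorm {n₁ n₂ : ℕ} (X : Matrix (Fin n₁) (Fin n₂) 𝕜) : ℝ :=
  √(frobInner X X)

/-- The singular values `σ₁(X) ≥ … ≥ σₙ(X)`, `n = min n₁ n₂`. -/
def sigma {n₁ n₂ : ℕ} (X : Matrix (Fin n₁) (Fin n₂) 𝕜) : Fin (min n₁ n₂) → ℝ :=
  fun i => (Matrix.toEuclideanLin X).singularValues i

/-- The nuclear norm. -/
def nuclearNorm {n₁ n₂ : ℕ} (X : Matrix (Fin n₁) (Fin n₂) 𝕜) : ℝ :=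
  ∑ i, sigma X i

/-- The spectral norm: the operator norm between Euclidean spaces. -/
def specNorm {n₁ n₂ : ℕ} (X : Matrix (Fin n₁) (Fin n₂) 𝕜) : ℝ :=
  ‖LinearMap.toContinuousLinearMap (Matrix.toEuclideanLin X)‖

/-- The rectangular diagonal matrix with diagonal `x`. -/
def rectDiag (𝕜 : Type*) [RCLike 𝕜] {n₁ n₂ : ℕ} (x : Fin (min n₁ n₂) → ℝ) :
    Matrix (Fin n₁) (Fin n₂) 𝕜 :=
  Matrix.of fun i j =>
    if h : (i : ℕ) = (j : ℕ) then ((x ⟨i, by have := i.isLt; have := j.isLt; omega⟩ : ℝ) : 𝕜) else 0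

/-- The set `𝕆^{n₁,n₂}(X)` of pairs `(U, V)` of orthogonal (unitary) matrices with
`X = U Diag(σ(X)) Vᴴ`. -/
def svdPairs {n₁ n₂ : ℕ} (X : Matrix (Fin n₁) (Fin n₂) 𝕜) :
    Set (Matrix (Fin n₁) (Fin n₁) 𝕜 × Matrix (Fin n₂) (Fin n₂) 𝕜) :=
  {UV | UV.1 ∈ Matrix.unitaryGroup (Fin n₁) 𝕜 ∧ UV.2 ∈ Matrix.unitaryGroup (Fin n₂) 𝕜 ∧
    X = UV.1 * rectDiag 𝕜 (sigma X) * UV.2ᴴ}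

/-- The singular value decompositions used for a space of the given kind. For the full space these
are all of `𝕆^{n₁,n₂}(X)`. For self-adjoint matrices they are the pairs `(P, P Diag(s))` coming from
an eigenvalue decomposition `X = P Diag(l) Pᴴ` with `|l₁| ≥ … ≥ |lₙ|`, where `sᵢ = -1` if `lᵢ < 0`
and `sᵢ = 1` otherwise. -/
def MatrixKind.svdPairs : {n₁ n₂ : ℕ} → MatrixKind n₁ n₂ → Matrix (Fin n₁) (Fin n₂) 𝕜 →
    Set (Matrix (Fin n₁) (Fin n₁) 𝕜 × Matrix (Fin n₂) (Fin n₂) 𝕜)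
  | _, _, .full _ _, X => RankCorrection.svdPairs X
  | _, _, .hermitian n, X =>
    {UV | ∃ P ∈ Matrix.unitaryGroup (Fin n) 𝕜, ∃ l : Fin n → ℝ,
      Antitone (fun i => |l i|) ∧
      X = P * Matrix.diagonal (fun i => ((l i : ℝ) : 𝕜)) * Pᴴ ∧
      UV.1 = P ∧ UV.2 = P * Matrix.diagonal (fun i => if l i < 0 then (-1 : 𝕜) else 1)}

/-- The first `r` columns `U₁` of `U`. -/
def firstCols {n r : ℕ} (U : Matrix (Fin n) (Fin n) 𝕜) (h : r ≤ n) : Matrix (Fin n) (Fin r) 𝕜 :=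
  U.submatrix id (Fin.castLE h)

/-- The last `n - r` columns `U₂` of `U`. -/
def lastCols {n : ℕ} (U : Matrix (Fin n) (Fin n) 𝕜) (r : ℕ) : Matrix (Fin n) (Fin (n - r)) 𝕜 :=
  U.submatrix id (fun j => ⟨r + j, by have := j.isLt; omega⟩)

/-! ### Spectral operators -/

/-- Signed permutation matrices: entries in `{0, 1, -1}`, exactly one nonzero entry in each row
and in each column. -/
def IsSignedPermutation {n : ℕ} (Q : Matrix (Fin n) (Fin n) ℝ) : Prop :=
  (∀ i j, Q i j = 0 ∨ Q i j = 1 ∨ Q i j = -1) ∧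
  (∀ i, ∃! j, Q i j ≠ 0) ∧ (∀ j, ∃! i, Q i j ≠ 0)

/-- A symmetric vector-valued function: `f(x) = Qᵀ f(Q x)` for all signed permutations `Q`. -/
def IsSymmetricFun {n : ℕ} (f : (Fin n → ℝ) → (Fin n → ℝ)) : Prop :=
  ∀ Q : Matrix (Fin n) (Fin n) ℝ, IsSignedPermutation Q → ∀ x, f x = Qᵀ *ᵥ f (Q *ᵥ x)

open Classical in
/-- The spectral operator `F(X) = U Diag(f(σ(X))) Vᴴ`, `(U, V) ∈ 𝕆^{n₁,n₂}(X)`. For a symmetric `f`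
the value does not depend on the pair `(U, V)`, so any choice of it gives the same operator. A pair
always exists (singular value decomposition), so the `else` branch is never used. -/
def spectralOperator {n₁ n₂ : ℕ} (f : (Fin (min n₁ n₂) → ℝ) → (Fin (min n₁ n₂) → ℝ))
    (X : Matrix (Fin n₁) (Fin n₂) 𝕜) : Matrix (Fin n₁) (Fin n₂) 𝕜 :=
  if h : (svdPairs X).Nonempty then h.some.1 * rectDiag 𝕜 (f (sigma X)) * h.some.2ᴴ else 0

/-! ### The observation model -/

/-- `Θ₁, …, Θ_d` is an orthonormal basis of the real inner product space `W`. -/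
def IsONBasis {n₁ n₂ d : ℕ} (W : Submodule ℝ (Matrix (Fin n₁) (Fin n₂) 𝕜))
    (Θ : Fin d → Matrix (Fin n₁) (Fin n₂) 𝕜) : Prop :=
  (∀ k l, frobInner (Θ k) (Θ l) = if k = l then 1 else 0) ∧
  Submodule.span ℝ (Set.range Θ) = W

/-- `p` is a probability distribution on the indices, zero on the set `α` of fixed indices and
positive on its complement. -/
def IsSamplingDistribution {d : ℕ} (α : Finset (Fin d)) (p : Fin d → ℝ) : Prop :=
  (∀ k ∈ α, p k = 0) ∧ (∀ k ∉ α, 0 < p k) ∧ ∑ k, p k = 1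

/-- The random sample. The indices `idx i` are i.i.d. with distribution `p`, the noises `ξ i` are
i.i.d. with mean zero and variance one, and all of them are independent of one another. -/
structure IsSample {Ω : Type*} [MeasurableSpace Ω] (P : Measure Ω) {d : ℕ} (p : Fin d → ℝ)
    (idx : ℕ → Ω → Fin d) (ξ : ℕ → Ω → ℝ) : Prop where
  measurable_idx : ∀ i, Measurable (idx i)
  measurable_noise : ∀ i, Measurable (ξ i)
  law_idx : ∀ i k, P {ω | idx i ω = k} = ENNReal.ofReal (p k)
  identDistrib_noise : ∀ i, IdentDistrib (ξ i) (ξ 0) P P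
  integrable_sq_noise : ∀ i, Integrable (fun ω => ξ i ω ^ 2) P
  mean_noise : ∀ i, ∫ ω, ξ i ω ∂P = 0
  variance_noise : ∀ i, ∫ ω, ξ i ω ^ 2 ∂P = 1
  indep_pair : ∀ i, IndepFun (idx i) (ξ i) P
  indep_seq : iIndepFun (fun i ω => (idx i ω, ξ i ω)) P

/-- The operator `𝒬_β†(X) = ∑_{k ∈ β} p_k⁻¹ ⟨Θ_k, X⟩ Θ_k`, where `β` is the complement of `α`. -/
def Qdagger {n₁ n₂ d : ℕ} (Θ : Fin d → Matrix (Fin n₁) (Fin n₂) 𝕜) (α : Finset (Fin d))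
    (p : Fin d → ℝ) (X : Matrix (Fin n₁) (Fin n₂) 𝕜) : Matrix (Fin n₁) (Fin n₂) 𝕜 :=
  ∑ k ∈ αᶜ, (1 / p k * frobInner (Θ k) X) • Θ k

/-- The linear system
`U₂ᴴ 𝒬_β†(U₂ Γ V₂ᴴ) V₂ = U₂ᴴ 𝒬_β†(U₁ V₁ᴴ - G) V₂`
at the matrix `X` of rank `r`, where `U = [U₁ U₂]` and `V = [V₁ V₂]` are split after `r` columns. -/
def SolvesSystem {n₁ n₂ d : ℕ} (Θ : Fin d → Matrix (Fin n₁) (Fin n₂) 𝕜) (α : Finset (Fin d))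
    (p : Fin d → ℝ) (X G : Matrix (Fin n₁) (Fin n₂) 𝕜)
    (U : Matrix (Fin n₁) (Fin n₁) 𝕜) (V : Matrix (Fin n₂) (Fin n₂) 𝕜)
    (Γ : Matrix (Fin (n₁ - X.rank)) (Fin (n₂ - X.rank)) 𝕜) : Prop :=
  (lastCols U X.rank)ᴴ *
      Qdagger Θ α p (lastCols U X.rank * Γ * (lastCols V X.rank)ᴴ) * lastCols V X.rank =
    (lastCols U X.rank)ᴴ *
      Qdagger Θ α p (firstCols U X.rank_le_height * (firstCols V X.rank_le_width)ᴴ - G) *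
        lastCols V X.rank

/-! ### The rank-correction step -/

/-- The objective function
`(2m)⁻¹ ‖y - R_Ω(X)‖² + ρ (‖X‖_* - ⟨G, X⟩ + (γ/2) ‖X - X₀‖_F²)`
for the first `m` observations `y i` of the coefficients with indices `idx i`. -/
def objective {n₁ n₂ d : ℕ} (Θ : Fin d → Matrix (Fin n₁) (Fin n₂) 𝕜) (m : ℕ)
    (idx : ℕ → Fin d) (y : ℕ → ℝ) (ρ γ : ℝ) (G X₀ X : Matrix (Fin n₁) (Fin n₂) 𝕜) : ℝ :=
  1 / (2 * (m : ℝ)) * ∑ i ∈ Finset.range m, (y i - frobInner (Θ (idx i)) X) ^ 2 +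
    ρ * (nuclearNorm X - frobInner G X + γ / 2 * frobNorm (X - X₀) ^ 2)

/-- The feasible set: the matrices of `W` whose basis coefficients with indices in `α` agree with
those of `Xbar`. -/
def feasibleSet {n₁ n₂ d : ℕ} (W : Submodule ℝ (Matrix (Fin n₁) (Fin n₂) 𝕜))
    (Θ : Fin d → Matrix (Fin n₁) (Fin n₂) 𝕜) (α : Finset (Fin d))
    (Xbar : Matrix (Fin n₁) (Fin n₂) 𝕜) : Set (Matrix (Fin n₁) (Fin n₂) 𝕜) :=
  {X | X ∈ W ∧ ∀ k ∈ α, frobInner (Θ k) X = frobInner (Θ k) Xbar}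

/-- `X` is an optimal solution of the rank-correction step. -/
def IsOptimal {n₁ n₂ d : ℕ} (W : Submodule ℝ (Matrix (Fin n₁) (Fin n₂) 𝕜))
    (Θ : Fin d → Matrix (Fin n₁) (Fin n₂) 𝕜) (α : Finset (Fin d))
    (Xbar : Matrix (Fin n₁) (Fin n₂) 𝕜) (m : ℕ) (idx : ℕ → Fin d) (y : ℕ → ℝ) (ρ γ : ℝ)
    (G X₀ X : Matrix (Fin n₁) (Fin n₂) 𝕜) : Prop :=
  X ∈ feasibleSet W Θ α Xbar ∧
    ∀ Z ∈ feasibleSet W Θ α Xbar,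
      objective Θ m idx y ρ γ G X₀ X ≤ objective Θ m idx y ρ γ G X₀ Z

/-! ### Asymptotic notions -/

/-- Random matrices, with measurability read entrywise. -/
def IsRandomMatrix {Ω : Type*} [MeasurableSpace Ω] {n₁ n₂ : ℕ}
    (X : Ω → Matrix (Fin n₁) (Fin n₂) 𝕜) : Prop :=
  ∀ i j, Measurable (fun ω => X ω i j)

/-- Convergence in probability of random matrices to a constant matrix. -/
def TendstoInProb {Ω : Type*} [MeasurableSpace Ω] (P : Measure Ω) {n₁ n₂ : ℕ}
    (X : ℕ → Ω → Matrix (Fin n₁) (Fin n₂) 𝕜) (Xbar : Matrix (Fin n₁) (Fin n₂) 𝕜) : Prop :=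
  ∀ ε : ℝ, 0 < ε → Tendsto (fun m => P {ω | ε ≤ frobNorm (X m ω - Xbar)}) atTop (𝓝 0)

/-- Boundedness in probability, `x_m = O_p(1)`. -/
def BoundedInProb {Ω : Type*} [MeasurableSpace Ω] (P : Measure Ω) (x : ℕ → Ω → ℝ) : Prop :=
  ∀ ε : ℝ, 0 < ε → ∃ C : ℝ, ∀ᶠ m in atTop, P {ω | C < |x m ω|} ≤ ENNReal.ofReal ε

/-- Rank consistency: `Pr(rank(X_m) = rank(Xbar)) → 1`. -/
def RankConsistent {Ω : Type*} [MeasurableSpace Ω] (P : Measure Ω) {n₁ n₂ : ℕ}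
    (X : ℕ → Ω → Matrix (Fin n₁) (Fin n₂) 𝕜) (Xbar : Matrix (Fin n₁) (Fin n₂) 𝕜) : Prop :=
  Tendsto (fun m => P {ω | (X m ω).rank = Xbar.rank}) atTop (𝓝 1)

end RankCorrection

end

/-! Expand X - Xbar in the orthonormal basis, with coordinates δ vanishing on α. By orthonormality,
up to constants the objective is ½ Σ N_k δ_k² - ρ Σ h_k δ_k + ρ‖Xbar + Σ δ_k Θ_k‖_*
(`IsONBasis.objective_shifted`). The randomness enters only through N, which is the empirical
frequencies plus γρ, and h, which collects the noise averages divided by ρ, the coefficients of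
F(X̃), and γ times the initial error. Chebyshev's inequality, √m ρ → ∞ and continuity of F give N →
p and h_k → ⟨Θ_k, F(Xbar)⟩ in probability (`IsSample.smallInProb_coordWeight`,
`IsSample.smallInProb_coordShift`). The rest is deterministic: when (N, h, ρ) is close to (p, ⟨Θ,
F(Xbar)⟩, 0+), every minimizer has rank r (`SystemData.eventually_rank_eq`).

A minimizer X has a dual certificate: a contraction W with ⟨W, X⟩ = ‖X‖_* and ⟨W, Θ_k⟩ = h_k - N_k
δ_k/ρ off α (`IsCoordMin.exists_certificate`). If W tends to W₀, then δ_k/ρ tends to p_k⁻¹⟨Θ_k, G -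
W₀⟩ with G = F(Xbar). Hence X → Xbar, and W₀ attains the nuclear norm of Xbar, which forces W₀ =
U₁V₁ᴴ + U₂Γ'V₂ᴴ. Let B be the same block matrix with -Γ̂ in place of Γ'. Then ⟨W - B, X⟩ ≥ 0 ≥ ⟨W -
B, Xbar⟩. Dividing by ρ and passing to the limit gives ⟨W₀ - B, 𝒬_β†(G - W₀)⟩ ≥ 0. The linear system
and positive semidefiniteness of 𝒬_β† turn this into 𝒬_β†(W₀ - B) = 0, so -Γ' solves the system, and
uniqueness gives W₀ = B (`eq_block_of_system_unique`). Compactness then yields W → B.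

Since ‖Γ̂‖ < 1, a certificate near B can act isometrically on at most r dimensions. As it maps the
right singular vectors of X to the left ones, rank X ≤ r (`rank_le_of_norm_sub_block_lt`). Lower
semicontinuity of the rank gives the other inequality. -/

noncomputable section

namespace RankCorrection

section

variable {𝕜 : Type*} [RCLike 𝕜] {n₁ n₂ : ℕ}

section

open scoped Matrix.Norms.L2Operator

/-! ### The trace inner product -/

/-- The trace inner product as a real bilinear form. -/
def frobBilin :
    Matrix (Fin n₁) (Fin n₂) 𝕜 →ₗ[ℝ] Matrix (Fin n₁) (Fin n₂) 𝕜 →ₗ[ℝ] ℝ :=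
  LinearMap.mk₂ ℝ frobInner
    (fun X Y Z => by simp [frobInner, Matrix.add_mul])
    (fun c X Y => by simp [frobInner, Matrix.trace_smul, RCLike.smul_re])
    (fun X Y Z => by simp [frobInner, Matrix.mul_add])
    (fun c X Y => by simp [frobInner, Matrix.trace_smul, RCLike.smul_re])


lemma frobInner_eq (X Y : Matrix (Fin n₁) (Fin n₂) 𝕜) : frobInner X Y = frobBilin X Y := rfl

lemma frobInner_add_left (X Y Z : Matrix (Fin n₁) (Fin n₂) 𝕜) :
    frobInner (X + Y) Z = frobInner X Z + frobInner Y Z := by simp [frobInner_eq]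

lemma frobInner_add_right (X Y Z : Matrix (Fin n₁) (Fin n₂) 𝕜) :
    frobInner X (Y + Z) = frobInner X Y + frobInner X Z := by simp [frobInner_eq]

lemma frobInner_sub_left (X Y Z : Matrix (Fin n₁) (Fin n₂) 𝕜) :
    frobInner (X - Y) Z = frobInner X Z - frobInner Y Z := by simp [frobInner_eq]

lemma frobInner_sub_right (X Y Z : Matrix (Fin n₁) (Fin n₂) 𝕜) :
    frobInner X (Y - Z) = frobInner X Y - frobInner X Z := by simp [frobInner_eq]

lemma frobInner_smul_left (c : ℝ) (X Y : Matrix (Fin n₁) (Fin n₂) 𝕜) :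
    frobInner (c • X) Y = c * frobInner X Y := by simp [frobInner_eq]

lemma frobInner_smul_right (c : ℝ) (X Y : Matrix (Fin n₁) (Fin n₂) 𝕜) :
    frobInner X (c • Y) = c * frobInner X Y := by simp [frobInner_eq]

lemma frobInner_sum_left {ι : Type*} (s : Finset ι) (X : ι → Matrix (Fin n₁) (Fin n₂) 𝕜)
    (Y : Matrix (Fin n₁) (Fin n₂) 𝕜) :
    frobInner (∑ i ∈ s, X i) Y = ∑ i ∈ s, frobInner (X i) Y := by
  simp [frobInner_eq]

lemma frobInner_sum_right {ι : Type*} (s : Finset ι) (X : Matrix (Fin n₁) (Fin n₂) 𝕜)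
    (Y : ι → Matrix (Fin n₁) (Fin n₂) 𝕜) :
    frobInner X (∑ i ∈ s, Y i) = ∑ i ∈ s, frobInner X (Y i) := by
  simp [frobInner_eq]

lemma frobInner_comm (X Y : Matrix (Fin n₁) (Fin n₂) 𝕜) : frobInner X Y = frobInner Y X := by
  unfold frobInner
  rw [← RCLike.conj_re, ← RCLike.star_def, ← Matrix.trace_conjTranspose,
    Matrix.conjTranspose_mul, Matrix.conjTranspose_conjTranspose]

lemma frobInner_conjTranspose (X Y : Matrix (Fin n₁) (Fin n₂) 𝕜) :
    frobInner Xᴴ Yᴴ = frobInner X Y := by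
  rw [frobInner_comm X Y]
  unfold frobInner
  rw [Matrix.conjTranspose_conjTranspose, Matrix.trace_mul_comm]

lemma frobInner_self (X : Matrix (Fin n₁) (Fin n₂) 𝕜) :
    frobInner X X = ∑ j, ∑ i, ‖X i j‖ ^ 2 := by
  unfold frobInner
  simp only [Matrix.trace, Matrix.diag, Matrix.mul_apply, Matrix.conjTranspose_apply, map_sum]
  refine Finset.sum_congr rfl fun j _ => Finset.sum_congr rfl fun i _ => ?_
  rw [RCLike.star_def, RCLike.conj_mul]
  norm_cast

lemma frobInner_self_nonneg (X : Matrix (Fin n₁) (Fin n₂) 𝕜) : 0 ≤ frobInner X X := by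
  rw [frobInner_self]; positivity

lemma frobNorm_sq (X : Matrix (Fin n₁) (Fin n₂) 𝕜) : frobNorm X ^ 2 = frobInner X X :=
  Real.sq_sqrt (frobInner_self_nonneg X)

lemma frobNorm_nonneg (X : Matrix (Fin n₁) (Fin n₂) 𝕜) : 0 ≤ frobNorm X := Real.sqrt_nonneg _

lemma norm_apply_le_frobNorm (X : Matrix (Fin n₁) (Fin n₂) 𝕜) (i : Fin n₁) (j : Fin n₂) :
    ‖X i j‖ ≤ frobNorm X := by
  refine Real.le_sqrt_of_sq_le ?_
  rw [frobInner_self]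
  calc ‖X i j‖ ^ 2 ≤ ∑ i, ‖X i j‖ ^ 2 :=
        Finset.single_le_sum (f := fun i => ‖X i j‖ ^ 2) (fun _ _ => by positivity)
          (Finset.mem_univ i)
    _ ≤ _ := Finset.single_le_sum (f := fun j => ∑ i, ‖X i j‖ ^ 2)
          (fun _ _ => by positivity) (Finset.mem_univ j)

lemma continuous_frobInner_left (Y : Matrix (Fin n₁) (Fin n₂) 𝕜) :
    Continuous fun X => frobInner X Y :=
  (frobBilin.flip Y).continuous_of_finiteDimensional

lemma continuous_frobInner :
    Continuous fun q : Matrix (Fin n₁) (Fin n₂) 𝕜 × Matrix (Fin n₁) (Fin n₂) 𝕜 =>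
      frobInner q.1 q.2 := by
  unfold frobInner
  exact RCLike.continuous_re.comp
    ((continuous_fst.matrix_conjTranspose.matrix_mul continuous_snd).matrix_trace)

lemma tendsto_nhds_of_frobNorm {ι : Type*} {l : Filter ι} {X : ι → Matrix (Fin n₁) (Fin n₂) 𝕜}
    {X₀ : Matrix (Fin n₁) (Fin n₂) 𝕜} (h : Tendsto (fun i => frobNorm (X i - X₀)) l (𝓝 0)) :
    Tendsto X l (𝓝 X₀) := by
  refine tendsto_pi_nhds.2 fun i => tendsto_pi_nhds.2 fun j => ?_
  refine tendsto_iff_norm_sub_tendsto_zero.2 (squeeze_zero (fun _ => norm_nonneg _) ?_ h)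
  intro k
  exact norm_apply_le_frobNorm (X k - X₀) i j

/-! ### Matrices with orthonormal columns -/

/-- By the C*-identity the norm only depends on (UA)ᴴ(UA) = AᴴA. -/
lemma norm_mul_of_conjTranspose_mul_self {l m n : Type*} [Fintype l] [Fintype m] [Fintype n]
    [DecidableEq l] [DecidableEq m] [DecidableEq n] {U : Matrix l m 𝕜}
    (hU : Uᴴ * U = 1) (A : Matrix m n 𝕜) : ‖U * A‖ = ‖A‖ := by
  have h : ‖U * A‖ * ‖U * A‖ = ‖A‖ * ‖A‖ := by
    rw [← Matrix.l2_opNorm_conjTranspose_mul_self, ← Matrix.l2_opNorm_conjTranspose_mul_self,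
      Matrix.conjTranspose_mul, Matrix.mul_assoc, ← Matrix.mul_assoc Uᴴ, hU, Matrix.one_mul]
  exact (mul_self_inj (norm_nonneg _) (norm_nonneg _)).1 h

lemma norm_le_one_of_conjTranspose_mul_self {l m : Type*} [Fintype l] [Fintype m]
    [DecidableEq l] [DecidableEq m] {U : Matrix l m 𝕜}
    (hU : Uᴴ * U = 1) : ‖U‖ ≤ 1 := by
  have := norm_mul_of_conjTranspose_mul_self hU (1 : Matrix m m 𝕜)
  rw [Matrix.mul_one] at this
  rw [this, ← Matrix.diagonal_one, Matrix.l2_opNorm_diagonal]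
  refine (pi_norm_le_iff_of_nonneg zero_le_one).2 fun i => by simp

lemma norm_apply_le_l2_opNorm {m n : Type*} [Fintype m] [Fintype n] [DecidableEq m]
    [DecidableEq n] (A : Matrix m n 𝕜) (i : m) (j : n) : ‖A i j‖ ≤ ‖A‖ := by
  have h := A.l2_opNorm_mulVec (EuclideanSpace.single j (1 : 𝕜))
  rw [PiLp.norm_single, norm_one, mul_one] at h
  refine le_trans ?_ h
  have := PiLp.norm_apply_le ((EuclideanSpace.equiv m 𝕜).symm
    (A *ᵥ (EuclideanSpace.single j (1 : 𝕜)).ofLp)) i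
  simpa using this

/-! ### The singular value decomposition and the nuclear norm -/

lemma finrank_range_toEuclideanLin (X : Matrix (Fin n₁) (Fin n₂) 𝕜) :
    Module.finrank 𝕜 (Matrix.toEuclideanLin X).range = X.rank := by
  rw [Matrix.toEuclideanLin, Matrix.toLpLin_eq_toLin, ← Matrix.rank_eq_finrank_range_toLin]

lemma sigma_nonneg (X : Matrix (Fin n₁) (Fin n₂) 𝕜) (i) : 0 ≤ sigma X i :=
  LinearMap.singularValues_nonneg _ _

lemma sigma_pos_iff (X : Matrix (Fin n₁) (Fin n₂) 𝕜) (i : Fin (min n₁ n₂)) :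
    0 < sigma X i ↔ (i : ℕ) < X.rank := by
  rw [sigma, LinearMap.singularValues_pos_iff_lt_finrank_range, finrank_range_toEuclideanLin]

/-- The thin singular value decomposition: `X = U Diag(s) Vᴴ` with orthonormal columns in `U` and
`V`, and with positive `s`, the sum of which is the nuclear norm. -/
lemma exists_thin_svd (X : Matrix (Fin n₁) (Fin n₂) 𝕜) :
    ∃ (U : Matrix (Fin n₁) (Fin X.rank) 𝕜) (V : Matrix (Fin n₂) (Fin X.rank) 𝕜)
      (s : Fin X.rank → ℝ), Uᴴ * U = 1 ∧ Vᴴ * V = 1 ∧ (∀ i, 0 < s i) ∧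
        X = U * diagonal (fun i => (s i : 𝕜)) * Vᴴ ∧ nuclearNorm X = ∑ i, s i := by
  set T := Matrix.toEuclideanLin X with hTdef
  have hsym := T.isSymmetric_adjoint_comp_self
  have hn : Module.finrank 𝕜 (EuclideanSpace 𝕜 (Fin n₂)) = n₂ := by simp
  set b := hsym.eigenvectorBasis hn with hb
  have hR : X.rank ≤ n₂ := X.rank_le_width
  have hrk := finrank_range_toEuclideanLin X
  -- The images under T of the eigenvectors of T*T are orthogonal with squared lengths σᵢ², so
  -- normalizing the nonzero ones gives the left singular vectors.
  have hgram : ∀ i j, inner 𝕜 (T (b i)) (T (b j)) =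
      if i = j then ((T.singularValues i ^ 2 : ℝ) : 𝕜) else 0 := by
    intro i j
    rw [← LinearMap.adjoint_inner_right, ← LinearMap.comp_apply, hsym.apply_eigenvectorBasis hn j,
      inner_smul_right, ← T.sq_singularValues_fin hn, orthonormal_iff_ite.1 b.orthonormal i j]
    by_cases h : i = j <;> simp [h]
  let s : Fin X.rank → ℝ := fun i => T.singularValues i
  have hs : ∀ i, 0 < s i := fun i =>
    (T.singularValues_pos_iff_lt_finrank_range).2 (by rw [hrk]; exact i.2)
  let V : Matrix (Fin n₂) (Fin X.rank) 𝕜 := Matrix.of fun i k => (b (Fin.castLE hR k)).ofLp i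
  let U : Matrix (Fin n₁) (Fin X.rank) 𝕜 :=
    Matrix.of fun i k => ((s k)⁻¹ : 𝕜) * (T (b (Fin.castLE hR k))).ofLp i
  refine ⟨U, V, s, ?_, ?_, hs, ?_, ?_⟩
  · ext j k
    have h := hgram (Fin.castLE hR j) (Fin.castLE hR k)
    rw [PiLp.inner_apply] at h
    have : (Uᴴ * U) j k = ((s j)⁻¹ : 𝕜) * ((s k)⁻¹ : 𝕜) *
        ∑ i, inner 𝕜 ((T (b (Fin.castLE hR j))).ofLp i) ((T (b (Fin.castLE hR k))).ofLp i) := by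
      rw [Finset.mul_sum]
      simp only [Matrix.mul_apply, Matrix.conjTranspose_apply, U, Matrix.of_apply]
      refine Finset.sum_congr rfl fun i _ => ?_
      simp [RCLike.inner_apply]
      ring
    rw [this, h]
    by_cases hjk : j = k
    · subst hjk
      have h0 : (s j : 𝕜) ≠ 0 := by exact_mod_cast (hs j).ne'
      have : ((T.singularValues (Fin.castLE hR j) ^ 2 : ℝ) : 𝕜) = (s j : 𝕜) ^ 2 := by
        simp [s]
      rw [if_pos rfl, this, Matrix.one_apply_eq]
      field_simp
    · rw [if_neg (by simpa using hjk), Matrix.one_apply_ne hjk, mul_zero]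
  · ext j k
    have h := orthonormal_iff_ite.1 b.orthonormal (Fin.castLE hR j) (Fin.castLE hR k)
    rw [PiLp.inner_apply] at h
    have : (Vᴴ * V) j k =
        ∑ i, inner 𝕜 ((b (Fin.castLE hR j)).ofLp i) ((b (Fin.castLE hR k)).ofLp i) := by
      simp only [Matrix.mul_apply, Matrix.conjTranspose_apply, V, Matrix.of_apply]
      refine Finset.sum_congr rfl fun i _ => ?_
      simp [RCLike.inner_apply, mul_comm]
    rw [this, h, Matrix.one_apply]
    simp [Fin.ext_iff]
  -- Eigenvectors with index at least the rank are killed by T, so expanding a standard basis vector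
  -- in the eigenbasis and applying T leaves only the first rank-many terms.
  · have hker : ∀ k : Fin n₂, ¬ ((k : ℕ) < X.rank) → T (b k) = 0 := by
      intro k hk
      have h := hgram k k
      have h0 : T.singularValues k = 0 :=
        T.singularValues_eq_zero_iff_le_finrank_range.2 (by rw [hrk]; omega)
      rw [if_pos rfl, h0] at h
      simpa using h
    ext i j
    have h1 : X i j = (T (EuclideanSpace.single j (1 : 𝕜))).ofLp i := by
      rw [hTdef, Matrix.ofLp_toLpLin]; simp
    have h2 : T (EuclideanSpace.single j (1 : 𝕜)) =
        ∑ k, star ((b k).ofLp j) • T (b k) := by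
      conv_lhs => rw [← b.sum_repr (EuclideanSpace.single j (1 : 𝕜))]
      rw [map_sum]
      refine Finset.sum_congr rfl fun k _ => ?_
      rw [map_smul, b.repr_apply_apply, EuclideanSpace.inner_single_right]
      simp
    have h3 : (∑ k, star ((b k).ofLp j) • T (b k)) =
        ∑ k : Fin X.rank, star ((b (Fin.castLE hR k)).ofLp j) • T (b (Fin.castLE hR k)) := by
      symm
      refine Finset.sum_of_injOn (Fin.castLE hR) (Fin.castLE_injective hR).injOn (by simp) ?_
        (fun _ _ => rfl)
      intro k _ hk
      rw [hker k, smul_zero]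
      intro hlt
      exact hk ⟨⟨k, hlt⟩, by simp, by ext; simp⟩
    rw [h1, h2, h3, Matrix.mul_apply]
    simp only [Matrix.mul_diagonal, Matrix.conjTranspose_apply, U, V, Matrix.of_apply]
    rw [WithLp.ofLp_sum, Finset.sum_apply]
    refine Finset.sum_congr rfl fun k _ => ?_
    have h0 : (s k : 𝕜) ≠ 0 := by exact_mod_cast (hs k).ne'
    simp only [WithLp.ofLp_smul, Pi.smul_apply, smul_eq_mul]
    field_simp
  · unfold nuclearNorm sigma
    rw [Fin.sum_univ_eq_sum_range (fun i => T.singularValues i),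
      Fin.sum_univ_eq_sum_range (fun i => T.singularValues i)]
    symm
    refine Finset.sum_subset ?_ ?_
    · exact Finset.range_subset_range.2 (le_min X.rank_le_height X.rank_le_width)
    · intro i _ hi
      refine T.singularValues_eq_zero_iff_le_finrank_range.2 ?_
      rw [hrk]; simpa using hi

/-- Reduces duality between spectral and nuclear norm to diagonal entries: for a contraction W and
orthonormal columns in U and V, those of UᴴWV have modulus at most 1. -/
lemma frobInner_mul_diagonal_mul {m : Type*} [Fintype m] [DecidableEq m]
    (W : Matrix (Fin n₁) (Fin n₂) 𝕜) (U : Matrix (Fin n₁) m 𝕜)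
    (V : Matrix (Fin n₂) m 𝕜) (s : m → ℝ) :
    frobInner W (U * diagonal (fun i => (s i : 𝕜)) * Vᴴ) =
      ∑ i, s i * RCLike.re ((Uᴴ * W * V) i i) := by
  rw [frobInner_comm]
  unfold frobInner
  rw [Matrix.conjTranspose_mul, Matrix.conjTranspose_mul, Matrix.conjTranspose_conjTranspose,
    Matrix.diagonal_conjTranspose, Matrix.mul_assoc, Matrix.trace_mul_comm, Matrix.mul_assoc,
    Matrix.mul_assoc]
  simp only [Matrix.trace, Matrix.diag, Matrix.diagonal_mul, map_sum, ← Matrix.mul_assoc]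
  refine Finset.sum_congr rfl fun i _ => ?_
  simp

lemma norm_conjTranspose_mul_mul_le {m : Type*} [Fintype m] [DecidableEq m]
    {W : Matrix (Fin n₁) (Fin n₂) 𝕜}
    {U : Matrix (Fin n₁) m 𝕜} {V : Matrix (Fin n₂) m 𝕜} (hU : Uᴴ * U = 1) (hV : Vᴴ * V = 1) :
    ‖Uᴴ * W * V‖ ≤ ‖W‖ := by
  have hU' : ‖Uᴴ‖ ≤ 1 := by
    rw [Matrix.l2_opNorm_conjTranspose]; exact norm_le_one_of_conjTranspose_mul_self hU
  have hV' := norm_le_one_of_conjTranspose_mul_self hV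
  calc ‖Uᴴ * W * V‖ ≤ ‖Uᴴ * W‖ * ‖V‖ := Matrix.l2_opNorm_mul _ _
    _ ≤ ‖Uᴴ * W‖ * 1 := by gcongr
    _ ≤ ‖Uᴴ‖ * ‖W‖ := by rw [mul_one]; exact Matrix.l2_opNorm_mul _ _
    _ ≤ 1 * ‖W‖ := by gcongr
    _ = ‖W‖ := one_mul _

lemma frobInner_thin_le {m : Type*} [Fintype m] [DecidableEq m]
    {W : Matrix (Fin n₁) (Fin n₂) 𝕜} (hW : ‖W‖ ≤ 1)
    {U : Matrix (Fin n₁) m 𝕜} {V : Matrix (Fin n₂) m 𝕜} (hU : Uᴴ * U = 1) (hV : Vᴴ * V = 1)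
    {s : m → ℝ} (hs : ∀ i, 0 < s i) :
    frobInner W (U * diagonal (fun i => (s i : 𝕜)) * Vᴴ) ≤ ∑ i, s i := by
  rw [frobInner_mul_diagonal_mul]
  refine Finset.sum_le_sum fun i _ => mul_le_of_le_one_right (hs i).le ?_
  exact (RCLike.re_le_norm _).trans ((norm_apply_le_l2_opNorm _ i i).trans
    ((norm_conjTranspose_mul_mul_le hU hV).trans hW))

/-- Column by column, ‖a - u‖² = ‖a‖² - 2 Re⟨u, a⟩ + 1 ≤ 1 - 2 + 1 = 0: equality in Cauchy–Schwarz.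
-/
lemma mul_eq_of_re_diag_eq_one {m : Type*} [Fintype m] [DecidableEq m]
    {A U : Matrix (Fin n₁) m 𝕜} (hA : ‖A‖ ≤ 1) (hU : Uᴴ * U = 1)
    (h : ∀ i, RCLike.re ((Uᴴ * A) i i) = 1) : A = U := by
  have key : ∀ j, ∑ i, ‖(A - U) i j‖ ^ 2 ≤ 0 := by
    intro j
    have e : ∑ i, ‖(A - U) i j‖ ^ 2 = RCLike.re (((A - U)ᴴ * (A - U)) j j) := by
      simp only [Matrix.mul_apply, Matrix.conjTranspose_apply, map_sum]
      refine Finset.sum_congr rfl fun i _ => ?_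
      rw [RCLike.star_def, RCLike.conj_mul]
      norm_cast
    have e2 : (A - U)ᴴ * (A - U) = Aᴴ * A - Aᴴ * U - Uᴴ * A + 1 := by
      rw [Matrix.conjTranspose_sub, Matrix.sub_mul, Matrix.mul_sub, Matrix.mul_sub, hU]
      abel
    have e3 : RCLike.re ((Aᴴ * U) j j) = 1 := by
      rw [← h j, ← RCLike.conj_re ((Uᴴ * A) j j), ← RCLike.star_def,
        ← Matrix.conjTranspose_apply, Matrix.conjTranspose_mul, Matrix.conjTranspose_conjTranspose]
    have e4 : RCLike.re ((Aᴴ * A) j j) ≤ 1 := by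
      refine (RCLike.re_le_norm _).trans ((norm_apply_le_l2_opNorm _ j j).trans ?_)
      rw [Matrix.l2_opNorm_conjTranspose_mul_self]
      exact mul_le_one₀ hA (norm_nonneg _) hA
    rw [e, e2]
    simp only [Matrix.add_apply, Matrix.sub_apply, map_add, map_sub, e3, h j,
      Matrix.one_apply_eq, RCLike.one_re]
    linarith
  ext i j
  have h0 : ‖(A - U) i j‖ ^ 2 ≤ 0 :=
    (Finset.single_le_sum (f := fun i => ‖(A - U) i j‖ ^ 2) (fun _ _ => by positivity)
      (Finset.mem_univ i)).trans (key j)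
  have h1 : ‖(A - U) i j‖ = 0 := pow_eq_zero_iff two_ne_zero |>.1 (le_antisymm h0 (by positivity))
  rw [norm_eq_zero, Matrix.sub_apply, sub_eq_zero] at h1
  exact h1

/-- Equality in a sum of termwise inequalities with positive weights forces every diagonal entry of
UᴴWV to have real part 1. So a contraction attaining the nuclear norm exchanges left and right
singular vectors. -/
lemma mul_eq_of_frobInner_thin {m : Type*} [Fintype m] [DecidableEq m]
    {W : Matrix (Fin n₁) (Fin n₂) 𝕜} (hW : ‖W‖ ≤ 1)
    {U : Matrix (Fin n₁) m 𝕜} {V : Matrix (Fin n₂) m 𝕜} (hU : Uᴴ * U = 1) (hV : Vᴴ * V = 1)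
    {s : m → ℝ} (hs : ∀ i, 0 < s i)
    (h : ∑ i, s i ≤ frobInner W (U * diagonal (fun i => (s i : 𝕜)) * Vᴴ)) :
    W * V = U ∧ Wᴴ * U = V := by
  rw [frobInner_mul_diagonal_mul] at h
  have hle : ∀ i, RCLike.re ((Uᴴ * W * V) i i) ≤ 1 := fun i =>
    (RCLike.re_le_norm _).trans ((norm_apply_le_l2_opNorm _ i i).trans
      ((norm_conjTranspose_mul_mul_le hU hV).trans hW))
  have hterm : ∀ i ∈ Finset.univ, s i * RCLike.re ((Uᴴ * W * V) i i) ≤ s i := fun i _ =>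
    mul_le_of_le_one_right (hs i).le (hle i)
  have heq : ∀ i, RCLike.re ((Uᴴ * W * V) i i) = 1 := by
    intro i
    have := (Finset.sum_eq_sum_iff_of_le hterm).1 (le_antisymm (Finset.sum_le_sum hterm) h) i
      (Finset.mem_univ i)
    exact mul_left_cancel₀ (hs i).ne' (by rw [this, mul_one])
  have hV' := norm_le_one_of_conjTranspose_mul_self hV
  have hU' := norm_le_one_of_conjTranspose_mul_self hU
  constructor
  · refine mul_eq_of_re_diag_eq_one ?_ hU fun i => by rw [← Matrix.mul_assoc]; exact heq i
    exact (Matrix.l2_opNorm_mul _ _).trans (mul_le_one₀ hW (norm_nonneg _) hV')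
  · refine mul_eq_of_re_diag_eq_one ?_ hV fun i => ?_
    · refine (Matrix.l2_opNorm_mul _ _).trans (mul_le_one₀ ?_ (norm_nonneg _) hU')
      rwa [Matrix.l2_opNorm_conjTranspose]
    · rw [← heq i, ← RCLike.conj_re ((Uᴴ * W * V) i i), ← RCLike.star_def,
        ← Matrix.conjTranspose_apply, Matrix.conjTranspose_mul, Matrix.conjTranspose_mul,
        Matrix.conjTranspose_conjTranspose]

/-- The pairing of a contraction with a matrix is at most the nuclear norm. -/
lemma frobInner_le_nuclearNorm {W : Matrix (Fin n₁) (Fin n₂) 𝕜} (hW : ‖W‖ ≤ 1)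
    (Z : Matrix (Fin n₁) (Fin n₂) 𝕜) : frobInner W Z ≤ nuclearNorm Z := by
  obtain ⟨U, V, s, hU, hV, hs, hZ, hn⟩ := exists_thin_svd Z
  rw [hn]
  conv_lhs => rw [hZ]
  exact frobInner_thin_le hW hU hV hs

/-- The nuclear norm is attained as the pairing with a contraction. -/
lemma exists_frobInner_eq_nuclearNorm (Z : Matrix (Fin n₁) (Fin n₂) 𝕜) :
    ∃ W : Matrix (Fin n₁) (Fin n₂) 𝕜, ‖W‖ ≤ 1 ∧ frobInner W Z = nuclearNorm Z := by
  obtain ⟨U, V, s, hU, hV, hs, hZ, hn⟩ := exists_thin_svd Z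
  refine ⟨U * Vᴴ, ?_, ?_⟩
  · rw [norm_mul_of_conjTranspose_mul_self hU, Matrix.l2_opNorm_conjTranspose]
    exact norm_le_one_of_conjTranspose_mul_self hV
  · rw [hn]
    trans frobInner (U * Vᴴ) (U * diagonal (fun i => (s i : 𝕜)) * Vᴴ)
    · rw [← hZ]
    rw [frobInner_mul_diagonal_mul]
    refine Finset.sum_congr rfl fun i _ => ?_
    rw [← Matrix.mul_assoc, hU, Matrix.one_mul, hV]
    simp

lemma nuclearNorm_nonneg (Z : Matrix (Fin n₁) (Fin n₂) 𝕜) : 0 ≤ nuclearNorm Z :=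
  Finset.sum_nonneg fun _ _ => sigma_nonneg _ _

/-- Once the nuclear norm is known to be a maximum of linear functionals over contractions,
subadditivity is immediate; homogeneity below follows the same way. -/
lemma nuclearNorm_add_le (Y Z : Matrix (Fin n₁) (Fin n₂) 𝕜) :
    nuclearNorm (Y + Z) ≤ nuclearNorm Y + nuclearNorm Z := by
  obtain ⟨W, hW, h⟩ := exists_frobInner_eq_nuclearNorm (Y + Z)
  rw [← h, frobInner_add_right]
  exact add_le_add (frobInner_le_nuclearNorm hW _) (frobInner_le_nuclearNorm hW _)

lemma nuclearNorm_smul {c : ℝ} (hc : 0 ≤ c) (Z : Matrix (Fin n₁) (Fin n₂) 𝕜) :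
    nuclearNorm (c • Z) = c * nuclearNorm Z := by
  apply le_antisymm
  · obtain ⟨W, hW, h⟩ := exists_frobInner_eq_nuclearNorm (c • Z)
    rw [← h, frobInner_smul_right]
    exact mul_le_mul_of_nonneg_left (frobInner_le_nuclearNorm hW _) hc
  · obtain ⟨W, hW, h⟩ := exists_frobInner_eq_nuclearNorm Z
    rw [← h, ← frobInner_smul_right]
    exact frobInner_le_nuclearNorm hW _


end

/-! ### Limits of pairings; convexity and continuity of the nuclear norm. -/

section

open scoped Matrix.Norms.Elementwise

lemma tendsto_frobInner {ι : Type*} {l : Filter ι} {n₁ n₂ : ℕ}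
    {X Y : ι → Matrix (Fin n₁) (Fin n₂) 𝕜}
    {X₀ Y₀ : Matrix (Fin n₁) (Fin n₂) 𝕜} (hX : Tendsto X l (𝓝 X₀)) (hY : Tendsto Y l (𝓝 Y₀)) :
    Tendsto (fun i => frobInner (X i) (Y i)) l (𝓝 (frobInner X₀ Y₀)) := by
  have h : ContinuousAt (fun q : Matrix (Fin n₁) (Fin n₂) 𝕜 × Matrix (Fin n₁) (Fin n₂) 𝕜 =>
      frobInner q.1 q.2) (X₀, Y₀) := continuous_frobInner.continuousAt
  have h' := h.tendsto.comp (hX.prodMk_nhds hY)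
  exact h'

lemma convexOn_nuclearNorm {n₁ n₂ : ℕ} :
    ConvexOn ℝ Set.univ (nuclearNorm : Matrix (Fin n₁) (Fin n₂) 𝕜 → ℝ) := by
  refine ⟨convex_univ, fun X _ Y _ a b ha hb _ => ?_⟩
  refine (nuclearNorm_add_le _ _).trans ?_
  rw [nuclearNorm_smul ha, nuclearNorm_smul hb]
  simp

lemma continuous_nuclearNorm {n₁ n₂ : ℕ} :
    Continuous (nuclearNorm : Matrix (Fin n₁) (Fin n₂) 𝕜 → ℝ) := by
  have := (convexOn_nuclearNorm (𝕜 := 𝕜) (n₁ := n₁) (n₂ := n₂)).continuousOn isOpen_univ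
  exact continuousOn_univ.1 this

end

end

/-! ### Contractions in block form -/

section Blocks

open scoped Matrix.Norms.L2Operator

variable {𝕜 : Type*} [RCLike 𝕜] {n₁ n₂ : ℕ} {m : Type*} [Fintype m] [DecidableEq m] {k₁ k₂ : ℕ}
  {U₁ : Matrix (Fin n₁) m 𝕜} {U₂ : Matrix (Fin n₁) (Fin k₁) 𝕜}
  {V₁ : Matrix (Fin n₂) m 𝕜} {V₂ : Matrix (Fin n₂) (Fin k₂) 𝕜}

lemma norm_toLp_sq {n : Type*} [Fintype n] (v : n → 𝕜) :
    ‖WithLp.toLp 2 v‖ ^ 2 = RCLike.re (star v ⬝ᵥ v) := by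
  rw [EuclideanSpace.norm_sq_eq]
  simp only [dotProduct, map_sum, Pi.star_apply, RCLike.star_def, RCLike.conj_mul]
  norm_cast

lemma star_mulVec_dotProduct_mulVec {l m n : Type*} [Fintype l] [Fintype m] [Fintype n]
    (A : Matrix l m 𝕜) (B : Matrix l n 𝕜) (v : m → 𝕜) (w : n → 𝕜) :
    star (A *ᵥ v) ⬝ᵥ (B *ᵥ w) = star v ⬝ᵥ ((Aᴴ * B) *ᵥ w) := by
  rw [Matrix.star_mulVec, ← Matrix.mulVec_mulVec, ← Matrix.dotProduct_mulVec]

/-- A block-diagonal matrix with an identity block and a contraction is a contraction. -/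
lemma norm_block_le_one (hU₁ : U₁ᴴ * U₁ = 1) (hU₂ : U₂ᴴ * U₂ = 1) (hU₁₂ : U₁ᴴ * U₂ = 0)
    (hV : V₁ * V₁ᴴ + V₂ * V₂ᴴ = 1) {Γ : Matrix (Fin k₁) (Fin k₂) 𝕜} (hΓ : ‖Γ‖ ≤ 1) :
    ‖U₁ * V₁ᴴ + U₂ * Γ * V₂ᴴ‖ ≤ 1 := by
  have hU₂₁ : U₂ᴴ * U₁ = 0 := by
    rw [← Matrix.conjTranspose_conjTranspose (U₂ᴴ * U₁)]
    simp [hU₁₂]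
  rw [Matrix.l2_opNorm_def]
  refine ContinuousLinearMap.opNorm_le_bound _ zero_le_one fun x => ?_
  set v := x.ofLp
  -- Pythagoras in the range, since the columns of U₁ and U₂ are mutually orthogonal; `h2` below is
  -- Pythagoras in the domain.
  have h1 : ‖WithLp.toLp 2 ((U₁ * V₁ᴴ + U₂ * Γ * V₂ᴴ) *ᵥ v)‖ ^ 2 =
      ‖WithLp.toLp 2 (V₁ᴴ *ᵥ v)‖ ^ 2 + ‖WithLp.toLp 2 (Γ *ᵥ (V₂ᴴ *ᵥ v))‖ ^ 2 := by
    have : (U₁ * V₁ᴴ + U₂ * Γ * V₂ᴴ) *ᵥ v = U₁ *ᵥ (V₁ᴴ *ᵥ v) + U₂ *ᵥ (Γ *ᵥ (V₂ᴴ *ᵥ v)) := by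
      simp [Matrix.add_mulVec, Matrix.mulVec_mulVec, Matrix.mul_assoc]
    rw [this, norm_toLp_sq, norm_toLp_sq, norm_toLp_sq, star_add, add_dotProduct, dotProduct_add,
      dotProduct_add]
    simp only [star_mulVec_dotProduct_mulVec U₁ U₁, star_mulVec_dotProduct_mulVec U₁ U₂,
      star_mulVec_dotProduct_mulVec U₂ U₁, star_mulVec_dotProduct_mulVec U₂ U₂,
      hU₁, hU₂, hU₁₂, hU₂₁]
    simp
  have h2 : ‖WithLp.toLp 2 v‖ ^ 2 =
      ‖WithLp.toLp 2 (V₁ᴴ *ᵥ v)‖ ^ 2 + ‖WithLp.toLp 2 (V₂ᴴ *ᵥ v)‖ ^ 2 := by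
    rw [norm_toLp_sq, norm_toLp_sq, norm_toLp_sq, star_mulVec_dotProduct_mulVec,
      star_mulVec_dotProduct_mulVec, Matrix.conjTranspose_conjTranspose,
      Matrix.conjTranspose_conjTranspose, ← map_add, ← dotProduct_add, ← Matrix.add_mulVec, hV,
      Matrix.one_mulVec]
  have h3 : ‖WithLp.toLp 2 (Γ *ᵥ (V₂ᴴ *ᵥ v))‖ ≤ ‖WithLp.toLp 2 (V₂ᴴ *ᵥ v)‖ :=
    (Γ.l2_opNorm_mulVec (WithLp.toLp 2 (V₂ᴴ *ᵥ v))).trans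
      (mul_le_of_le_one_left (norm_nonneg _) hΓ)
  rw [one_mul]
  change ‖WithLp.toLp 2 ((U₁ * V₁ᴴ + U₂ * Γ * V₂ᴴ) *ᵥ v)‖ ≤ ‖WithLp.toLp 2 v‖
  refine (sq_le_sq₀ (norm_nonneg _) (norm_nonneg _)).1 ?_
  rw [h1, h2]
  gcongr

/-- The two equations fix the first block column and the first block row of W in the bases [U₁ U₂]
and [V₁ V₂]; only the lower right block stays free. The proof inserts both resolutions of the
identity around W. -/
lemma eq_block_of_mul_eq (hU : U₁ * U₁ᴴ + U₂ * U₂ᴴ = 1) (hV : V₁ * V₁ᴴ + V₂ * V₂ᴴ = 1)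
    (hU₁₂ : U₁ᴴ * U₂ = 0) {W : Matrix (Fin n₁) (Fin n₂) 𝕜}
    (h₁ : W * V₁ = U₁) (h₂ : Wᴴ * U₁ = V₁) :
    W = U₁ * V₁ᴴ + U₂ * (U₂ᴴ * W * V₂) * V₂ᴴ := by
  have hU₂₁ : U₂ᴴ * U₁ = 0 := by
    rw [← Matrix.conjTranspose_conjTranspose (U₂ᴴ * U₁)]
    simp [hU₁₂]
  have h₂' : U₁ᴴ * W = V₁ᴴ := by
    rw [← h₂, Matrix.conjTranspose_mul, Matrix.conjTranspose_conjTranspose]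
  have e1 : W = U₁ * V₁ᴴ + U₂ * U₂ᴴ * W := by
    conv_lhs => rw [← Matrix.one_mul W, ← hU, Matrix.add_mul, Matrix.mul_assoc U₁, h₂']
  have e2 : U₂ᴴ * W = U₂ᴴ * W * V₂ * V₂ᴴ := by
    conv_lhs => rw [← Matrix.mul_one W, ← hV, Matrix.mul_add, ← Matrix.mul_assoc W, h₁,
      Matrix.mul_add, ← Matrix.mul_assoc, hU₂₁, Matrix.zero_mul, zero_add]
    simp only [Matrix.mul_assoc]
  conv_lhs => rw [e1, Matrix.mul_assoc, e2]
  simp only [Matrix.mul_assoc]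

/-- If the contraction `W` attains the nuclear norm of `X` and is close to a block-diagonal matrix
with an identity block and a strict contraction `Γ`, then the rank of `X` is at most the size of the
identity block. -/
lemma rank_le_of_norm_sub_block_lt (hV₂ : V₂ᴴ * V₂ = 1) (hU₂ : U₂ᴴ * U₂ = 1)
    {Γ : Matrix (Fin k₁) (Fin k₂) 𝕜} {W X : Matrix (Fin n₁) (Fin n₂) 𝕜} (hW : ‖W‖ ≤ 1)
    (hWX : nuclearNorm X ≤ frobInner W X)
    (hclose : ‖W - (U₁ * V₁ᴴ + U₂ * Γ * V₂ᴴ)‖ < 1 - ‖Γ‖) : X.rank ≤ Fintype.card m := by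
  by_contra! hlt
  obtain ⟨U, V, s, hU, hV, hs, hX, hn⟩ := exists_thin_svd X
  have hWV : W * V = U := by
    refine (mul_eq_of_frobInner_thin hW hU hV hs ?_).1
    rw [← hX, ← hn]; exact hWX
  -- If the rank exceeded the number of columns of V₁, some nonzero combination Vz of right singular
  -- vectors would be orthogonal to all columns of V₁.
  have hker : LinearMap.ker (V₁ᴴ * V).mulVecLin ≠ ⊥ :=
    LinearMap.ker_ne_bot_of_finrank_lt (by simpa using hlt)
  obtain ⟨z, hz, hz0⟩ := (Submodule.ne_bot_iff _).1 hker
  rw [LinearMap.mem_ker, Matrix.mulVecLin_apply] at hz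
  -- The vector z is carried as a one-column matrix so that the operator norm lemmas apply to it.
  set Z : Matrix (Fin X.rank) (Fin 1) 𝕜 := Matrix.of fun i _ => z i
  have hZ : V₁ᴴ * (V * Z) = 0 := by
    rw [← Matrix.mul_assoc]
    ext i j
    exact congrFun hz i
  have hZ0 : 0 < ‖Z‖ := by
    refine norm_pos_iff.2 fun h => hz0 (funext fun i => ?_)
    exact congrFun (congrFun h i) 0
  have hV₂' : ‖V₂ᴴ‖ ≤ 1 := by
    rw [Matrix.l2_opNorm_conjTranspose]; exact norm_le_one_of_conjTranspose_mul_self hV₂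
  have e : U * Z = (W - (U₁ * V₁ᴴ + U₂ * Γ * V₂ᴴ)) * (V * Z) + U₂ * (Γ * (V₂ᴴ * (V * Z))) := by
    rw [Matrix.sub_mul, Matrix.add_mul, Matrix.mul_assoc U₁, hZ, ← Matrix.mul_assoc W, hWV]
    simp [Matrix.mul_assoc]
  -- W maps VZ isometrically to UZ, whereas on the kernel of V₁ᴴ the block matrix shrinks by the
  -- factor ‖Γ‖; closeness makes the total factor smaller than 1.
  have h1 : ‖Z‖ ≤ ‖W - (U₁ * V₁ᴴ + U₂ * Γ * V₂ᴴ)‖ * ‖Z‖ + ‖Γ‖ * ‖Z‖ := by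
    calc ‖Z‖ = ‖U * Z‖ := (norm_mul_of_conjTranspose_mul_self hU Z).symm
      _ ≤ ‖(W - (U₁ * V₁ᴴ + U₂ * Γ * V₂ᴴ)) * (V * Z)‖ + ‖U₂ * (Γ * (V₂ᴴ * (V * Z)))‖ := by
        rw [e]; exact norm_add_le _ _
      _ ≤ ‖W - (U₁ * V₁ᴴ + U₂ * Γ * V₂ᴴ)‖ * ‖V * Z‖ + ‖Γ‖ * (‖V₂ᴴ‖ * ‖V * Z‖) := by
        rw [norm_mul_of_conjTranspose_mul_self hU₂]
        refine add_le_add (Matrix.l2_opNorm_mul _ _) ((Matrix.l2_opNorm_mul _ _).trans ?_)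
        exact mul_le_mul_of_nonneg_left (Matrix.l2_opNorm_mul _ _) (norm_nonneg _)
      _ ≤ ‖W - (U₁ * V₁ᴴ + U₂ * Γ * V₂ᴴ)‖ * ‖Z‖ + ‖Γ‖ * ‖Z‖ := by
        rw [norm_mul_of_conjTranspose_mul_self hV]
        gcongr
        exact mul_le_of_le_one_left (norm_nonneg _) hV₂'
  nlinarith

/-- Lower semicontinuity of the rank. -/
lemma eventually_card_le_rank {s : m → ℝ} (hU₁ : U₁ᴴ * U₁ = 1) (hV₁ : V₁ᴴ * V₁ = 1)
    (hs : ∀ i, 0 < s i) :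
    ∀ᶠ X in 𝓝 (U₁ * diagonal (fun i => (s i : 𝕜)) * V₁ᴴ), Fintype.card m ≤ X.rank := by
  -- The compression U₁ᴴXV₁ is invertible at the limit, hence nearby, and its rank is at most that
  -- of X.
  have hcont : Continuous fun X : Matrix (Fin n₁) (Fin n₂) 𝕜 => (U₁ᴴ * X * V₁).det :=
    ((continuous_const.matrix_mul continuous_id).matrix_mul continuous_const).matrix_det
  have h0 : (U₁ᴴ * (U₁ * diagonal (fun i => (s i : 𝕜)) * V₁ᴴ) * V₁).det ≠ 0 := by
    have : U₁ᴴ * (U₁ * diagonal (fun i => (s i : 𝕜)) * V₁ᴴ) * V₁ =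
        (U₁ᴴ * U₁) * diagonal (fun i => (s i : 𝕜)) * (V₁ᴴ * V₁) := by
      simp only [Matrix.mul_assoc]
    rw [this, hU₁, hV₁, Matrix.one_mul, Matrix.mul_one, Matrix.det_diagonal]
    exact Finset.prod_ne_zero_iff.2 fun i _ => by exact_mod_cast (hs i).ne'
  filter_upwards [hcont.continuousAt.eventually_ne h0] with X hX
  rw [← Matrix.rank_of_isUnit (U₁ᴴ * X * V₁)
    ((Matrix.isUnit_iff_isUnit_det _).2 (isUnit_iff_ne_zero.2 hX))]
  exact (Matrix.rank_mul_le_left _ _).trans (Matrix.rank_mul_le_right _ _)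

end Blocks

/-! ### The operator `𝒬_β†` and the linear system -/

section System

variable {𝕜 : Type*} [RCLike 𝕜] {n₁ n₂ d : ℕ} {m : Type*} [Fintype m] [DecidableEq m] {k₁ k₂ : ℕ}
  {Θ : Fin d → Matrix (Fin n₁) (Fin n₂) 𝕜} {α : Finset (Fin d)} {p : Fin d → ℝ}

lemma Qdagger_add (X Y : Matrix (Fin n₁) (Fin n₂) 𝕜) :
    Qdagger Θ α p (X + Y) = Qdagger Θ α p X + Qdagger Θ α p Y := by
  simp only [Qdagger, frobInner_add_right, mul_add, add_smul, Finset.sum_add_distrib]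

lemma Qdagger_smul (c : ℝ) (X : Matrix (Fin n₁) (Fin n₂) 𝕜) :
    Qdagger Θ α p (c • X) = c • Qdagger Θ α p X := by
  simp only [Qdagger, frobInner_smul_right, Finset.smul_sum, smul_smul]
  refine Finset.sum_congr rfl fun k _ => ?_
  ring_nf

lemma Qdagger_neg (X : Matrix (Fin n₁) (Fin n₂) 𝕜) :
    Qdagger Θ α p (-X) = -Qdagger Θ α p X := by
  rw [← neg_one_smul ℝ X, Qdagger_smul, neg_one_smul]

lemma Qdagger_sub (X Y : Matrix (Fin n₁) (Fin n₂) 𝕜) :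
    Qdagger Θ α p (X - Y) = Qdagger Θ α p X - Qdagger Θ α p Y := by
  rw [sub_eq_add_neg, Qdagger_add, Qdagger_neg, sub_eq_add_neg]

lemma frobInner_Qdagger_self (X : Matrix (Fin n₁) (Fin n₂) 𝕜) :
    frobInner X (Qdagger Θ α p X) = ∑ k ∈ αᶜ, 1 / p k * frobInner (Θ k) X ^ 2 := by
  rw [Qdagger, frobInner_sum_right]
  refine Finset.sum_congr rfl fun k _ => ?_
  rw [frobInner_smul_right, frobInner_comm X]
  ring

/-- The quadratic form is a sum of squares with positive weights over the complement of α, so its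
nonpositivity kills each coefficient that enters 𝒬_β†. -/
lemma Qdagger_eq_zero_of_frobInner_nonpos (hp : ∀ k ∉ α, 0 < p k)
    {X : Matrix (Fin n₁) (Fin n₂) 𝕜} (h : frobInner X (Qdagger Θ α p X) ≤ 0) :
    Qdagger Θ α p X = 0 := by
  rw [frobInner_Qdagger_self] at h
  have hnn : ∀ k ∈ αᶜ, 0 ≤ 1 / p k * frobInner (Θ k) X ^ 2 := fun k hk => by
    have := hp k (Finset.mem_compl.1 hk)
    positivity
  have h0 := (Finset.sum_eq_zero_iff_of_nonneg hnn).1 (le_antisymm h (Finset.sum_nonneg hnn))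
  refine Finset.sum_eq_zero fun k hk => ?_
  have hk' := (one_div_pos.2 (hp k (Finset.mem_compl.1 hk))).ne'
  have := (mul_eq_zero.1 (h0 k hk)).resolve_left hk'
  rw [pow_eq_zero_iff two_ne_zero] at this
  rw [this, mul_zero, zero_smul]

/-- Compression to the corner is adjoint to embedding the corner; this is how the linear system, an
identity between corners, becomes an orthogonality relation. -/
lemma frobInner_mul_mul_conjTranspose (U : Matrix (Fin n₁) (Fin k₁) 𝕜)
    (V : Matrix (Fin n₂) (Fin k₂) 𝕜) (Γ : Matrix (Fin k₁) (Fin k₂) 𝕜)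
    (Y : Matrix (Fin n₁) (Fin n₂) 𝕜) :
    frobInner (U * Γ * Vᴴ) Y = frobInner Γ (Uᴴ * Y * V) := by
  unfold frobInner
  rw [Matrix.conjTranspose_mul, Matrix.conjTranspose_mul, Matrix.conjTranspose_conjTranspose,
    Matrix.mul_assoc V, Matrix.trace_mul_comm V]
  simp only [Matrix.mul_assoc]

open scoped Matrix.Norms.L2Operator

/-- The dual certificate at the limit is determined by the linear system. -/
lemma eq_block_of_system_unique
    {U₁ : Matrix (Fin n₁) m 𝕜} {U₂ : Matrix (Fin n₁) (Fin k₁) 𝕜}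
    {V₁ : Matrix (Fin n₂) m 𝕜} {V₂ : Matrix (Fin n₂) (Fin k₂) 𝕜} {s : m → ℝ}
    (hp : ∀ k ∉ α, 0 < p k)
    (hU₁ : U₁ᴴ * U₁ = 1) (hV₁ : V₁ᴴ * V₁ = 1) (hU₁₂ : U₁ᴴ * U₂ = 0)
    (hU : U₁ * U₁ᴴ + U₂ * U₂ᴴ = 1) (hV : V₁ * V₁ᴴ + V₂ * V₂ᴴ = 1) (hs : ∀ i, 0 < s i)
    {G W : Matrix (Fin n₁) (Fin n₂) 𝕜} {Γ : Matrix (Fin k₁) (Fin k₂) 𝕜}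
    (hsol : U₂ᴴ * Qdagger Θ α p (U₂ * Γ * V₂ᴴ) * V₂ =
      U₂ᴴ * Qdagger Θ α p (U₁ * V₁ᴴ - G) * V₂)
    (huniq : U₂ᴴ * Qdagger Θ α p (U₂ * (-(U₂ᴴ * W * V₂)) * V₂ᴴ) * V₂ =
      U₂ᴴ * Qdagger Θ α p (U₁ * V₁ᴴ - G) * V₂ → -(U₂ᴴ * W * V₂) = Γ)
    (hW : ‖W‖ ≤ 1)
    (hWX : ∑ i, s i ≤ frobInner W (U₁ * diagonal (fun i => (s i : 𝕜)) * V₁ᴴ))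
    (hmono : 0 ≤ frobInner (W - (U₁ * V₁ᴴ + U₂ * (-Γ) * V₂ᴴ)) (Qdagger Θ α p (G - W))) :
    W = U₁ * V₁ᴴ + U₂ * (-Γ) * V₂ᴴ := by
  obtain ⟨h₁, h₂⟩ := mul_eq_of_frobInner_thin hW hU₁ hV₁ hs hWX
  have hWb := eq_block_of_mul_eq hU hV hU₁₂ h₁ h₂
  set Γ' := U₂ᴴ * W * V₂ with hΓ'
  set E := U₂ * (Γ' + Γ) * V₂ᴴ with hE
  have hWE : W - (U₁ * V₁ᴴ + U₂ * (-Γ) * V₂ᴴ) = E := by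
    conv_lhs => rw [hWb]
    rw [hE, Matrix.mul_add, Matrix.add_mul, Matrix.mul_neg, Matrix.neg_mul]
    abel
  have hGW : G - W = -(U₁ * V₁ᴴ - G) + U₂ * Γ * V₂ᴴ - E := by
    rw [← hWE, Matrix.mul_neg, Matrix.neg_mul]
    abel
  -- The residual of the linear system at Γ vanishes in the corner, and E lives in that corner.
  have hE0 : frobInner E (Qdagger Θ α p (-(U₁ * V₁ᴴ - G) + U₂ * Γ * V₂ᴴ)) = 0 := by
    rw [hE, frobInner_mul_mul_conjTranspose, Qdagger_add, Qdagger_neg, Matrix.mul_add,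
      Matrix.add_mul, hsol]
    simp [frobInner]
  -- With the cross term gone, `hmono` reads 0 ≤ -⟨E, 𝒬_β†E⟩.
  have hQE : Qdagger Θ α p E = 0 := by
    refine Qdagger_eq_zero_of_frobInner_nonpos hp ?_
    rw [hWE, hGW, Qdagger_sub, frobInner_sub_right, hE0] at hmono
    linarith
  have hneg : U₂ * (-Γ') * V₂ᴴ = U₂ * Γ * V₂ᴴ - E := by
    rw [hE, Matrix.mul_add, Matrix.add_mul, Matrix.mul_neg, Matrix.neg_mul]
    abel
  -- Replacing Γ by -Γ' changes the left side of the system only through 𝒬_β†E = 0, so -Γ' is a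
  -- solution as well.
  have hΓ := huniq (by rw [hneg, Qdagger_sub, hQE, sub_zero, hsol])
  rw [hWb, ← hΓ, neg_neg]

end System

/-! ### The rank-correction step in coordinates -/

section Coordinates

open scoped Matrix.Norms.L2Operator

variable {𝕜 : Type*} [RCLike 𝕜] {n₁ n₂ d : ℕ}

/-- The matrix `X + ∑ₖ δₖ Θₖ`. -/
def shifted (Θ : Fin d → Matrix (Fin n₁) (Fin n₂) 𝕜) (X : Matrix (Fin n₁) (Fin n₂) 𝕜)
    (δ : Fin d → ℝ) : Matrix (Fin n₁) (Fin n₂) 𝕜 :=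
  X + ∑ k, δ k • Θ k

/-- The objective function of the rank-correction step in the coordinates of `X - Xbar`, up to
constants. -/
def coordObjective (Θ : Fin d → Matrix (Fin n₁) (Fin n₂) 𝕜) (Xbar : Matrix (Fin n₁) (Fin n₂) 𝕜)
    (N h : Fin d → ℝ) (ρ : ℝ) (δ : Fin d → ℝ) : ℝ :=
  1 / 2 * ∑ k, N k * δ k ^ 2 - ρ * ∑ k, h k * δ k + ρ * nuclearNorm (shifted Θ Xbar δ)

/-- `δ` minimizes the coordinate objective among the vectors vanishing on `α`. -/
def IsCoordMin (Θ : Fin d → Matrix (Fin n₁) (Fin n₂) 𝕜) (α : Finset (Fin d))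
    (Xbar : Matrix (Fin n₁) (Fin n₂) 𝕜) (N h : Fin d → ℝ) (ρ : ℝ) (δ : Fin d → ℝ) : Prop :=
  (∀ k ∈ α, δ k = 0) ∧ ∀ e : Fin d → ℝ, (∀ k ∈ α, e k = 0) →
    coordObjective Θ Xbar N h ρ δ ≤ coordObjective Θ Xbar N h ρ e

variable {Θ : Fin d → Matrix (Fin n₁) (Fin n₂) 𝕜} {α : Finset (Fin d)}
  {Xbar : Matrix (Fin n₁) (Fin n₂) 𝕜}

lemma continuous_shifted : Continuous (shifted Θ Xbar) := by
  unfold shifted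
  refine continuous_const.add (continuous_finsetSum _ fun k _ => ?_)
  exact (continuous_apply k).smul continuous_const

lemma continuous_coordObjective (N h : Fin d → ℝ) (ρ : ℝ) :
    Continuous (coordObjective Θ Xbar N h ρ) := by
  unfold coordObjective
  have := continuous_nuclearNorm.comp (continuous_shifted (Θ := Θ) (Xbar := Xbar))
  fun_prop

lemma norm_sq_le_sum_sq (δ : Fin d → ℝ) : ‖δ‖ ^ 2 ≤ ∑ k, δ k ^ 2 := by
  have h : ‖δ‖ ≤ √(∑ k, δ k ^ 2) :=
    (pi_norm_le_iff_of_nonneg (Real.sqrt_nonneg _)).2 fun k =>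
      Real.abs_le_sqrt (Finset.single_le_sum (f := fun k => δ k ^ 2) (fun _ _ => sq_nonneg _)
        (Finset.mem_univ k))
  calc ‖δ‖ ^ 2 ≤ √(∑ k, δ k ^ 2) ^ 2 := by gcongr
    _ = _ := Real.sq_sqrt (Finset.sum_nonneg fun _ _ => sq_nonneg _)

lemma exists_isCoordMin {N h : Fin d → ℝ} {ρ : ℝ} (hN : ∀ k ∉ α, 0 < N k) (hρ : 0 < ρ) :
    ∃ δ, IsCoordMin Θ α Xbar N h ρ δ := by
  -- A uniform lower bound on the weights off α; when α is everything, any positive constant serves.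
  obtain ⟨c, hc, hcN⟩ : ∃ c : ℝ, 0 < c ∧ ∀ k ∉ α, c ≤ N k := by
    rcases (αᶜ).eq_empty_or_nonempty with he | hne
    · refine ⟨1, one_pos, fun k hk => ?_⟩
      have : k ∈ αᶜ := Finset.mem_compl.2 hk
      simp [he] at this
    · obtain ⟨k, hk, hmin⟩ := Finset.exists_min_image αᶜ N hne
      exact ⟨N k, hN k (Finset.mem_compl.1 hk), fun j hj => hmin j (Finset.mem_compl.2 hj)⟩
  set K : Set (Fin d → ℝ) := {δ | ∀ k ∈ α, δ k = 0} with hK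
  have hKc : IsClosed K := by
    simp only [hK, Set.ofPred_forall]
    exact isClosed_iInter fun k => isClosed_iInter fun _ =>
      isClosed_eq (continuous_apply k) continuous_const
  set H : ℝ := ρ * ∑ k, |h k| with hH
  have hH0 : 0 ≤ H := mul_nonneg hρ.le (Finset.sum_nonneg fun _ _ => abs_nonneg _)
  set C : ℝ := ρ * nuclearNorm Xbar with hC
  have hC0 : 0 ≤ C := mul_nonneg hρ.le (nuclearNorm_nonneg _)
  have h0 : coordObjective Θ Xbar N h ρ 0 = C := by simp [coordObjective, shifted, hC]
  have hlow : ∀ δ ∈ K, 1 / 2 * c * ‖δ‖ ^ 2 - H * ‖δ‖ ≤ coordObjective Θ Xbar N h ρ δ := by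
    intro δ hδ
    have h1 : c * ‖δ‖ ^ 2 ≤ ∑ k, N k * δ k ^ 2 := by
      refine (mul_le_mul_of_nonneg_left (norm_sq_le_sum_sq δ) hc.le).trans ?_
      rw [Finset.mul_sum]
      refine Finset.sum_le_sum fun k _ => ?_
      by_cases hk : k ∈ α
      · simp [hδ k hk]
      · exact mul_le_mul_of_nonneg_right (hcN k hk) (sq_nonneg _)
    have h2 : ∑ k, h k * δ k ≤ (∑ k, |h k|) * ‖δ‖ := by
      rw [Finset.sum_mul]
      refine Finset.sum_le_sum fun k _ => (le_abs_self _).trans ?_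
      rw [abs_mul]
      exact mul_le_mul_of_nonneg_left (norm_le_pi_norm δ k) (abs_nonneg _)
    have h3 := mul_le_mul_of_nonneg_left h2 hρ.le
    have h4 := mul_nonneg hρ.le (nuclearNorm_nonneg (shifted Θ Xbar δ))
    unfold coordObjective
    rw [hH, mul_assoc ρ]
    linarith
  -- For ‖δ‖ ≥ 1 and c‖δ‖ ≥ 2(H + C), the lower bound is at least (H + C)‖δ‖ - H‖δ‖ = C‖δ‖ ≥ C, the
  -- value at 0.
  have hcoer : ∀ᶠ δ in cocompact (Fin d → ℝ) ⊓ 𝓟 K,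
      coordObjective Θ Xbar N h ρ 0 ≤ coordObjective Θ Xbar N h ρ δ := by
    rw [eventually_inf_principal]
    filter_upwards [(tendsto_norm_cocompact_atTop (E := Fin d → ℝ)).eventually_ge_atTop
      (max 1 (2 * (H + C) / c))] with δ hδ hδK
    refine le_trans ?_ (hlow δ hδK)
    rw [h0]
    have h1 : 1 ≤ ‖δ‖ := (le_max_left _ _).trans hδ
    have h2 : 2 * (H + C) ≤ ‖δ‖ * c := (div_le_iff₀ hc).1 ((le_max_right _ _).trans hδ)
    nlinarith
  obtain ⟨δ, hδ, hmin⟩ := (continuous_coordObjective N h ρ).continuousOn.exists_isMinOn' hKc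
    (show (0 : Fin d → ℝ) ∈ K from fun _ _ => rfl) hcoer
  exact ⟨δ, hδ, fun e he => hmin he⟩

lemma norm_real_smul_l2 (a : ℝ) (W : Matrix (Fin n₁) (Fin n₂) 𝕜) : ‖a • W‖ = |a| * ‖W‖ := by
  rw [RCLike.real_smul_eq_coe_smul (K := 𝕜), norm_smul, RCLike.norm_ofReal]

/-- The contractions in the subspace `S`. -/
def contractions (S : Submodule ℝ (Matrix (Fin n₁) (Fin n₂) 𝕜)) :
    Set (Matrix (Fin n₁) (Fin n₂) 𝕜) :=
  {W | W ∈ S ∧ ‖W‖ ≤ 1}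

variable {S : Submodule ℝ (Matrix (Fin n₁) (Fin n₂) 𝕜)}

lemma isCompact_contractions : IsCompact (contractions S) := by
  have h1 : IsCompact (Metric.closedBall (0 : Matrix (Fin n₁) (Fin n₂) 𝕜) 1) := by
    have := FiniteDimensional.proper 𝕜 (Matrix (Fin n₁) (Fin n₂) 𝕜)
    exact isCompact_closedBall _ _
  have h2 : IsClosed (S : Set (Matrix (Fin n₁) (Fin n₂) 𝕜)) := S.closed_of_finiteDimensional
  have : contractions S = (S : Set (Matrix (Fin n₁) (Fin n₂) 𝕜)) ∩ Metric.closedBall 0 1 := by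
    ext W; simp [contractions]
  rw [this]
  exact h1.inter_left h2

lemma convex_contractions : Convex ℝ (contractions S) := by
  intro X hX Y hY a b ha hb hab
  refine ⟨S.add_mem (S.smul_mem a hX.1) (S.smul_mem b hY.1), ?_⟩
  refine (norm_add_le _ _).trans ?_
  rw [norm_real_smul_l2, norm_real_smul_l2, abs_of_nonneg ha, abs_of_nonneg hb]
  have := mul_le_mul_of_nonneg_left hX.2 ha
  have := mul_le_mul_of_nonneg_left hY.2 hb
  linarith

/-- The subspace `S` has enough contractions to represent the nuclear norm on `S`. -/
def IsNormed (S : Submodule ℝ (Matrix (Fin n₁) (Fin n₂) 𝕜)) : Prop :=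
  ∀ Z ∈ S, ∃ W ∈ contractions S, frobInner W Z = nuclearNorm Z

lemma sum_smul_mem (hΘ : ∀ k, Θ k ∈ S) (e : Fin d → ℝ) : ∑ k, e k • Θ k ∈ S :=
  S.sum_mem fun k _ => S.smul_mem _ (hΘ k)

/-- Compare δ with δ + te for small t > 0, bound the nuclear norm along the segment by convexity,
divide by t and let t → 0 so that the second-order term B drops out. The bracket on the left is the
negative gradient of the smooth part, divided by ρ. -/
lemma IsCoordMin.le_nuclearNorm_add_sub {N h : Fin d → ℝ} {ρ : ℝ} {δ : Fin d → ℝ} (hρ : 0 < ρ)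
    (hδ : IsCoordMin Θ α Xbar N h ρ δ) {e : Fin d → ℝ} (he : ∀ k ∈ α, e k = 0) :
    ∑ k, (h k - N k * δ k / ρ) * e k ≤
      nuclearNorm (shifted Θ Xbar δ + ∑ k, e k • Θ k) - nuclearNorm (shifted Θ Xbar δ) := by
  set X := shifted Θ Xbar δ with hX
  set E := ∑ k, e k • Θ k with hE
  have hsh : ∀ t : ℝ, shifted Θ Xbar (δ + t • e) = X + t • E := by
    intro t
    simp [hX, hE, shifted, add_smul, Finset.sum_add_distrib, Finset.smul_sum, smul_smul, add_assoc]
  have hconv : ∀ t : ℝ, 0 < t → t ≤ 1 →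
      nuclearNorm (X + t • E) ≤ (1 - t) * nuclearNorm X + t * nuclearNorm (X + E) := by
    intro t ht ht1
    have := (convexOn_nuclearNorm (𝕜 := 𝕜) (n₁ := n₁) (n₂ := n₂)).2 (Set.mem_univ X)
      (Set.mem_univ (X + E)) (by linarith : 0 ≤ 1 - t) ht.le (by ring)
    have e1 : (1 - t) • X + t • (X + E) = X + t • E := by
      rw [sub_smul, one_smul, smul_add]; abel
    rwa [e1] at this
  set A := ∑ k, N k * δ k * e k - ρ * ∑ k, h k * e k +
    ρ * (nuclearNorm (X + E) - nuclearNorm X) with hA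
  set B := 1 / 2 * ∑ k, N k * e k ^ 2 with hB
  have hAB : ∀ t : ℝ, 0 < t → t ≤ 1 → 0 ≤ A + t * B := by
    intro t ht ht1
    have h1 := hδ.2 (δ + t • e) fun k hk => by simp [hδ.1 k hk, he k hk]
    unfold coordObjective at h1
    rw [hsh, ← hX] at h1
    have h2 := mul_le_mul_of_nonneg_left (hconv t ht ht1) hρ.le
    have h3 : ∑ k, N k * (δ + t • e) k ^ 2 = ∑ k, N k * δ k ^ 2 +
        2 * t * ∑ k, N k * δ k * e k + t ^ 2 * ∑ k, N k * e k ^ 2 := by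
      rw [Finset.mul_sum, Finset.mul_sum, ← Finset.sum_add_distrib, ← Finset.sum_add_distrib]
      refine Finset.sum_congr rfl fun k _ => ?_
      simp only [Pi.add_apply, Pi.smul_apply, smul_eq_mul]
      ring
    have h4 : ∑ k, h k * (δ + t • e) k = ∑ k, h k * δ k + t * ∑ k, h k * e k := by
      rw [Finset.mul_sum, ← Finset.sum_add_distrib]
      refine Finset.sum_congr rfl fun k _ => ?_
      simp only [Pi.add_apply, Pi.smul_apply, smul_eq_mul]
      ring
    rw [h3, h4] at h1
    have h5 : 0 ≤ t * (A + t * B) := by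
      rw [hA, hB]
      nlinarith
    exact nonneg_of_mul_nonneg_right h5 ht
  have hA0 : 0 ≤ A := by
    have hlim : Tendsto (fun t : ℝ => A + t * B) (𝓝[>] 0) (𝓝 (A + 0 * B)) := by
      refine tendsto_nhdsWithin_of_tendsto_nhds ?_
      exact (by fun_prop : Continuous fun t : ℝ => A + t * B).tendsto 0
    rw [zero_mul, add_zero] at hlim
    refine ge_of_tendsto hlim ?_
    filter_upwards [Ioc_mem_nhdsGT (zero_lt_one' ℝ)] with t ht
    exact hAB t ht.1 ht.2
  have h6 : ∑ k, (h k - N k * δ k / ρ) * e k = ∑ k, h k * e k - (∑ k, N k * δ k * e k) / ρ := by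
    rw [Finset.sum_div, ← Finset.sum_sub_distrib]
    refine Finset.sum_congr rfl fun k _ => ?_
    ring
  rw [h6, sub_le_iff_le_add, ← sub_le_iff_le_add', le_div_iff₀ hρ]
  rw [hA] at hA0
  linarith

/-- The first-order optimality condition: a minimizer has a dual certificate in `S`. -/
lemma IsCoordMin.exists_certificate (hS : IsNormed S) (hΘ : ∀ k, Θ k ∈ S) (hXbar : Xbar ∈ S)
    {N h : Fin d → ℝ} {ρ : ℝ} {δ : Fin d → ℝ} (hρ : 0 < ρ)
    (hδ : IsCoordMin Θ α Xbar N h ρ δ) :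
    ∃ W ∈ contractions S, frobInner W (shifted Θ Xbar δ) = nuclearNorm (shifted Θ Xbar δ) ∧
      ∀ k ∉ α, frobInner W (Θ k) = h k - N k * δ k / ρ := by
  set X := shifted Θ Xbar δ with hX
  have hXS : X ∈ S := S.add_mem hXbar (sum_smul_mem hΘ δ)
  set c : Fin d → ℝ := fun k => h k - N k * δ k / ρ with hc
  -- This is the support-function inequality that membership of y in the image below requires. For t
  -- > 0 rescale the variational inequality by t; for t ≤ 0 use it with the triangle inequality,
  -- moving -tX to the other side.
  have key : ∀ e : Fin d → ℝ, (∀ k ∈ α, e k = 0) → ∀ t : ℝ,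
      ∑ k, c k * e k + t * nuclearNorm X ≤ nuclearNorm (∑ k, e k • Θ k + t • X) := by
    intro e he t
    rcases lt_or_ge 0 t with ht | ht
    · have h1 := hδ.le_nuclearNorm_add_sub hρ (e := t⁻¹ • e) fun k hk => by simp [he k hk]
      rw [← hX] at h1
      have h2 : ∑ k, e k • Θ k + t • X = t • (X + ∑ k, (t⁻¹ • e) k • Θ k) := by
        simp only [Pi.smul_apply, smul_eq_mul, smul_add, Finset.smul_sum, smul_smul,
          mul_inv_cancel_left₀ ht.ne']
        abel
      have h3 : ∑ k, c k * e k = t * ∑ k, c k * (t⁻¹ • e) k := by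
        rw [Finset.mul_sum]
        refine Finset.sum_congr rfl fun k _ => ?_
        simp only [Pi.smul_apply, smul_eq_mul]
        field_simp
      rw [h2, nuclearNorm_smul ht.le, h3, ← mul_add]
      exact mul_le_mul_of_nonneg_left (by linarith) ht.le
    · have h1 := hδ.le_nuclearNorm_add_sub hρ he
      rw [← hX] at h1
      have h2 := nuclearNorm_add_le X (∑ k, e k • Θ k)
      have h3 := nuclearNorm_add_le (∑ k, e k • Θ k + t • X) ((-t) • X)
      have h4 : ∑ k, e k • Θ k + t • X + (-t) • X = ∑ k, e k • Θ k := by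
        rw [neg_smul]; abel
      rw [h4, nuclearNorm_smul (by linarith)] at h3
      change ∑ k, c k * e k ≤ _ at h1
      linarith
  -- The conditions on a certificate as one linear equation A W = y over the compact convex set of
  -- contractions in S; the coordinates in α are zeroed on both sides and impose nothing.
  let A : Matrix (Fin n₁) (Fin n₂) 𝕜 →ₗ[ℝ] (Fin d → ℝ) × ℝ :=
    LinearMap.prod (LinearMap.pi fun k => if k ∈ α then 0 else frobBilin.flip (Θ k))
      (frobBilin.flip X)
  have hAk : ∀ W k, (A W).1 k = if k ∈ α then 0 else frobInner W (Θ k) := by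
    intro W k
    by_cases hk : k ∈ α <;> simp [A, hk, frobInner_eq]
  have hA2 : ∀ W, (A W).2 = frobInner W X := fun W => by simp [A, frobInner_eq]
  have hAc : Continuous A := A.continuous_of_finiteDimensional
  set y : (Fin d → ℝ) × ℝ := (fun k => if k ∈ α then 0 else c k, nuclearNorm X) with hy
  by_cases hmem : y ∈ A '' contractions S
  · obtain ⟨W, hW, hWy⟩ := hmem
    refine ⟨W, hW, ?_, fun k hk => ?_⟩
    · rw [← hA2, hWy]
    · have := congrFun (congrArg Prod.fst hWy) k
      rw [hAk, if_neg hk] at this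
      simpa [hy, hk] using this
  · exfalso
    -- A separating functional pairs with A W as ⟨W, Σ eₖΘₖ + tX⟩. By `IsNormed` some contraction in
    -- S raises this to the nuclear norm, which by `key` is at least g y: a contradiction.
    obtain ⟨g, u, hgu, huy⟩ := geometric_hahn_banach_closed_point
      (convex_contractions.linear_image A)
      (isCompact_contractions.image hAc).isClosed hmem
    have hg : ∀ z : (Fin d → ℝ) × ℝ,
        g z = ∑ k, z.1 k * g (Pi.single k 1, 0) + z.2 * g (0, 1) := by
      intro z
      have e1 : z = ∑ k, z.1 k • ((Pi.single k 1, 0) : (Fin d → ℝ) × ℝ) +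
          z.2 • ((0, 1) : (Fin d → ℝ) × ℝ) := by
        refine Prod.ext ?_ ?_
        · ext j
          simp [Prod.fst_sum, Finset.sum_apply, Pi.single_apply]
        · simp [Prod.snd_sum]
      conv_lhs => rw [e1]
      simp only [map_add, map_sum, map_smul, smul_eq_mul]
    set e : Fin d → ℝ := fun k => if k ∈ α then 0 else g (Pi.single k 1, 0) with he
    set t := g (0, 1) with ht
    have heα : ∀ k ∈ α, e k = 0 := fun k hk => by simp [he, hk]
    have hgA : ∀ W, g (A W) = frobInner W (∑ k, e k • Θ k + t • X) := by
      intro W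
      rw [hg, frobInner_add_right, frobInner_smul_right, frobInner_sum_right, hA2, mul_comm t]
      congr 1
      refine Finset.sum_congr rfl fun k _ => ?_
      rw [hAk, frobInner_smul_right]
      by_cases hk : k ∈ α <;> simp [he, hk, mul_comm]
    have hgy : g y = ∑ k, c k * e k + t * nuclearNorm X := by
      rw [hg, mul_comm t]
      congr 1
      refine Finset.sum_congr rfl fun k _ => ?_
      by_cases hk : k ∈ α <;> simp [hy, he, hk]
    obtain ⟨W, hW, hWn⟩ := hS (∑ k, e k • Θ k + t • X)
      (S.add_mem (sum_smul_mem hΘ e) (S.smul_mem t hXS))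
    have h1 := hgu (A W) ⟨W, hW, rfl⟩
    rw [hgA, hWn] at h1
    have h2 := key e heα t
    rw [← hgy] at h2
    linarith

end Coordinates

/-! ### The limit of the dual certificates -/

section Limit

open scoped Matrix.Norms.L2Operator

variable {𝕜 : Type*} [RCLike 𝕜] {n₁ n₂ d : ℕ} {m : Type*} [Fintype m] [DecidableEq m] {k₁ k₂ : ℕ}

/-- A decomposition `Xbar = U₁ Diag(s) V₁ᴴ` with positive `s`, the unitary completions `[U₁ U₂]` and
`[V₁ V₂]`, and a solution `Γ` of the linear system with spectral norm less than one, unique in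
`T`. -/
structure SystemData (S : Submodule ℝ (Matrix (Fin n₁) (Fin n₂) 𝕜))
    (T : Submodule ℝ (Matrix (Fin k₁) (Fin k₂) 𝕜))
    (Θ : Fin d → Matrix (Fin n₁) (Fin n₂) 𝕜) (α : Finset (Fin d)) (p : Fin d → ℝ)
    (Xbar G : Matrix (Fin n₁) (Fin n₂) 𝕜)
    (U₁ : Matrix (Fin n₁) m 𝕜) (U₂ : Matrix (Fin n₁) (Fin k₁) 𝕜)
    (V₁ : Matrix (Fin n₂) m 𝕜) (V₂ : Matrix (Fin n₂) (Fin k₂) 𝕜) (s : m → ℝ)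
    (Γ : Matrix (Fin k₁) (Fin k₂) 𝕜) : Prop where
  normed : IsNormed S
  basis_mem : ∀ k, Θ k ∈ S
  mem : Xbar ∈ S
  prob_pos : ∀ k ∉ α, 0 < p k
  left₁ : U₁ᴴ * U₁ = 1
  left₂ : U₂ᴴ * U₂ = 1
  left₁₂ : U₁ᴴ * U₂ = 0
  left_add : U₁ * U₁ᴴ + U₂ * U₂ᴴ = 1
  right₁ : V₁ᴴ * V₁ = 1
  right₂ : V₂ᴴ * V₂ = 1
  right_add : V₁ * V₁ᴴ + V₂ * V₂ᴴ = 1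
  pos : ∀ i, 0 < s i
  eq : Xbar = U₁ * diagonal (fun i => (s i : 𝕜)) * V₁ᴴ
  corner_mem : ∀ W ∈ S, U₂ᴴ * W * V₂ ∈ T
  solves : U₂ᴴ * Qdagger Θ α p (U₂ * Γ * V₂ᴴ) * V₂ =
    U₂ᴴ * Qdagger Θ α p (U₁ * V₁ᴴ - G) * V₂
  unique : ∀ Γ' ∈ T, U₂ᴴ * Qdagger Θ α p (U₂ * Γ' * V₂ᴴ) * V₂ =
    U₂ᴴ * Qdagger Θ α p (U₁ * V₁ᴴ - G) * V₂ → Γ' = Γ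
  norm_lt : ‖Γ‖ < 1

variable {S : Submodule ℝ (Matrix (Fin n₁) (Fin n₂) 𝕜)}
  {T : Submodule ℝ (Matrix (Fin k₁) (Fin k₂) 𝕜)}
  {Θ : Fin d → Matrix (Fin n₁) (Fin n₂) 𝕜} {α : Finset (Fin d)} {p : Fin d → ℝ}
  {Xbar G : Matrix (Fin n₁) (Fin n₂) 𝕜}
  {U₁ : Matrix (Fin n₁) m 𝕜} {U₂ : Matrix (Fin n₁) (Fin k₁) 𝕜}
  {V₁ : Matrix (Fin n₂) m 𝕜} {V₂ : Matrix (Fin n₂) (Fin k₂) 𝕜} {s : m → ℝ}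
  {Γ : Matrix (Fin k₁) (Fin k₂) 𝕜}

namespace SystemData

lemma block_norm_le (hD : SystemData S T Θ α p Xbar G U₁ U₂ V₁ V₂ s Γ) :
    ‖U₁ * V₁ᴴ + U₂ * (-Γ) * V₂ᴴ‖ ≤ 1 :=
  norm_block_le_one hD.left₁ hD.left₂ hD.left₁₂ hD.right_add (by rw [norm_neg]; exact hD.norm_lt.le)

lemma frobInner_block (hD : SystemData S T Θ α p Xbar G U₁ U₂ V₁ V₂ s Γ) :
    frobInner (U₁ * V₁ᴴ + U₂ * (-Γ) * V₂ᴴ) Xbar = ∑ i, s i := by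
  have hU₂₁ : U₁ᴴ * U₂ = 0 := hD.left₁₂
  rw [hD.eq, frobInner_mul_diagonal_mul]
  refine Finset.sum_congr rfl fun i _ => ?_
  have : U₁ᴴ * (U₁ * V₁ᴴ + U₂ * (-Γ) * V₂ᴴ) * V₁ = 1 := by
    rw [Matrix.mul_add, ← Matrix.mul_assoc, hD.left₁, ← Matrix.mul_assoc, ← Matrix.mul_assoc, hU₂₁]
    simp [hD.right₁]
  rw [this, Matrix.one_apply_eq, RCLike.one_re, mul_one]

lemma frobInner_le (hD : SystemData S T Θ α p Xbar G U₁ U₂ V₁ V₂ s Γ)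
    {W : Matrix (Fin n₁) (Fin n₂) 𝕜} (hW : ‖W‖ ≤ 1) : frobInner W Xbar ≤ ∑ i, s i := by
  rw [hD.eq]; exact frobInner_thin_le hW hD.left₁ hD.right₁ hD.pos

variable {ι : Type*} {l : Filter ι} {N h δ : ι → Fin d → ℝ} {ρ : ι → ℝ}
  {W : ι → Matrix (Fin n₁) (Fin n₂) 𝕜}

/-- Solve the stationarity equation for δ_k/ρ; this is legitimate in the limit because N_k → p_k >
0. -/
lemma tendsto_div (hD : SystemData S T Θ α p Xbar G U₁ U₂ V₁ V₂ s Γ)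
    {W₀ : Matrix (Fin n₁) (Fin n₂) 𝕜}
    (hN : Tendsto N l (𝓝 p)) (hh : Tendsto h l (𝓝 fun k => frobInner (Θ k) G))
    (hW₀ : Tendsto W l (𝓝 W₀))
    (hgrad : ∀ᶠ i in l, ∀ k ∉ α, frobInner (W i) (Θ k) = h i k - N i k * δ i k / ρ i)
    {k : Fin d} (hk : k ∉ α) :
    Tendsto (fun i => δ i k / ρ i) l (𝓝 (1 / p k * frobInner (Θ k) (G - W₀))) := by
  have hNk := tendsto_pi_nhds.1 hN k
  have hhk := tendsto_pi_nhds.1 hh k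
  have hpk := hD.prob_pos k hk
  have hWk : Tendsto (fun i => frobInner (W i) (Θ k)) l (𝓝 (frobInner W₀ (Θ k))) :=
    ((continuous_frobInner_left (Θ k)).tendsto W₀).comp hW₀
  have h1 : Tendsto (fun i => (N i k)⁻¹ * (h i k - frobInner (W i) (Θ k))) l
      (𝓝 ((p k)⁻¹ * (frobInner (Θ k) G - frobInner W₀ (Θ k)))) :=
    (hNk.inv₀ hpk.ne').mul (hhk.sub hWk)
  rw [one_div, frobInner_sub_right, frobInner_comm (Θ k) W₀]
  refine h1.congr' ?_
  filter_upwards [hgrad, hNk.eventually_ne hpk.ne'] with i hi hNi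
  rw [hi k hk]
  field_simp
  ring

/-- Off α, δ_k is ρ times a convergent quantity. -/
lemma tendsto_coord (hD : SystemData S T Θ α p Xbar G U₁ U₂ V₁ V₂ s Γ)
    {W₀ : Matrix (Fin n₁) (Fin n₂) 𝕜}
    (hN : Tendsto N l (𝓝 p)) (hh : Tendsto h l (𝓝 fun k => frobInner (Θ k) G))
    (hρ : Tendsto ρ l (𝓝 0)) (hρ_pos : ∀ᶠ i in l, 0 < ρ i)
    (hW₀ : Tendsto W l (𝓝 W₀)) (hδα : ∀ᶠ i in l, ∀ k ∈ α, δ i k = 0)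
    (hgrad : ∀ᶠ i in l, ∀ k ∉ α, frobInner (W i) (Θ k) = h i k - N i k * δ i k / ρ i) :
    Tendsto δ l (𝓝 0) := by
  refine tendsto_pi_nhds.2 fun k => ?_
  by_cases hk : k ∈ α
  · refine tendsto_const_nhds.congr' ?_
    filter_upwards [hδα] with i hi
    exact (hi k hk).symm
  · have := hρ.mul (hD.tendsto_div hN hh hW₀ hgrad hk)
    rw [zero_mul] at this
    refine this.congr' ?_
    filter_upwards [hρ_pos] with i hi
    field_simp

lemma tendsto_shifted (hδ : Tendsto δ l (𝓝 0)) :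
    Tendsto (fun i => shifted Θ Xbar (δ i)) l (𝓝 Xbar) := by
  have := ((continuous_shifted (Θ := Θ) (Xbar := Xbar)).tendsto 0).comp hδ
  have h0 : shifted Θ Xbar 0 = Xbar := by simp [shifted]
  rwa [h0] at this

/-- Both W and the block matrix B are contractions; W attains the nuclear norm at the minimizer and
B attains it at Xbar. The difference of these extremal properties, divided by ρ, survives in the
limit as the monotonicity inequality that `eq_block_of_system_unique` needs. -/
lemma limit_eq_block [l.NeBot] (hD : SystemData S T Θ α p Xbar G U₁ U₂ V₁ V₂ s Γ)
    {W₀ : Matrix (Fin n₁) (Fin n₂) 𝕜} (hW₀S : W₀ ∈ contractions S)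
    (hN : Tendsto N l (𝓝 p)) (hh : Tendsto h l (𝓝 fun k => frobInner (Θ k) G))
    (hρ : Tendsto ρ l (𝓝 0)) (hρ_pos : ∀ᶠ i in l, 0 < ρ i)
    (hW₀ : Tendsto W l (𝓝 W₀)) (hW : ∀ᶠ i in l, W i ∈ contractions S)
    (hWX : ∀ᶠ i in l, frobInner (W i) (shifted Θ Xbar (δ i)) = nuclearNorm (shifted Θ Xbar (δ i)))
    (hδα : ∀ᶠ i in l, ∀ k ∈ α, δ i k = 0)
    (hgrad : ∀ᶠ i in l, ∀ k ∉ α, frobInner (W i) (Θ k) = h i k - N i k * δ i k / ρ i) :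
    W₀ = U₁ * V₁ᴴ + U₂ * (-Γ) * V₂ᴴ := by
  set B := U₁ * V₁ᴴ + U₂ * (-Γ) * V₂ᴴ with hB
  have hX : Tendsto (fun i => shifted Θ Xbar (δ i)) l (𝓝 Xbar) :=
    tendsto_shifted (hD.tendsto_coord hN hh hρ hρ_pos hW₀ hδα hgrad)
  have hge : ∀ᶠ i in l, 0 ≤ frobInner (W i - B) (shifted Θ Xbar (δ i)) := by
    filter_upwards [hWX] with i hi
    rw [frobInner_sub_left, hi]
    exact sub_nonneg.2 (frobInner_le_nuclearNorm hD.block_norm_le _)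
  have hWB : Tendsto (fun i => W i - B) l (𝓝 (W₀ - B)) := hW₀.sub_const B
  have h1 : 0 ≤ frobInner (W₀ - B) Xbar :=
    ge_of_tendsto (tendsto_frobInner hWB hX) hge
  refine eq_block_of_system_unique hD.prob_pos hD.left₁ hD.right₁ hD.left₁₂ hD.left_add
    hD.right_add hD.pos (G := G) hD.solves
    (hD.unique _ (T.neg_mem (hD.corner_mem _ hW₀S.1))) hW₀S.2 ?_ ?_
  · rw [frobInner_sub_left, hD.frobInner_block] at h1
    rw [← hD.eq]
    linarith
  · have hlim : Tendsto (fun i => frobInner (W i - B) (∑ k ∈ αᶜ, (δ i k / ρ i) • Θ k)) l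
        (𝓝 (frobInner (W₀ - B) (Qdagger Θ α p (G - W₀)))) := by
      refine tendsto_frobInner hWB ?_
      unfold Qdagger
      refine tendsto_finsetSum _ fun k hk => ?_
      exact (hD.tendsto_div hN hh hW₀ hgrad (Finset.mem_compl.1 hk)).smul_const (Θ k)
    refine ge_of_tendsto hlim ?_
    -- Writing X = Xbar + ρ Σ (δ_k/ρ)Θ_k, the Xbar part of ⟨W - B, X⟩ ≥ 0 is nonpositive, so the ρ
    -- part is nonnegative and ρ can be cancelled.
    filter_upwards [hge, hW, hρ_pos, hδα] with i hi hWi hρi hδi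
    have h2 : frobInner (W i - B) Xbar ≤ 0 := by
      rw [frobInner_sub_left, hD.frobInner_block]
      have := hD.frobInner_le hWi.2
      linarith
    have h3 : shifted Θ Xbar (δ i) = Xbar + ρ i • ∑ k ∈ αᶜ, (δ i k / ρ i) • Θ k := by
      rw [shifted, Finset.smul_sum]
      congr 1
      rw [← Finset.sum_subset (Finset.subset_univ αᶜ)]
      · refine Finset.sum_congr rfl fun k _ => ?_
        rw [smul_smul, mul_div_cancel₀ _ hρi.ne']
      · intro k _ hk
        rw [hδi k (by simpa using hk), zero_smul]
    rw [h3, frobInner_add_right, frobInner_smul_right] at hi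
    exact nonneg_of_mul_nonneg_right (by linarith) hρi

/-- The certificates stay in a compact set, so every ultrafilter below l has a limit, and all these
limits coincide; no subsequences are needed. -/
lemma tendsto_certificate (hD : SystemData S T Θ α p Xbar G U₁ U₂ V₁ V₂ s Γ)
    (hN : Tendsto N l (𝓝 p)) (hh : Tendsto h l (𝓝 fun k => frobInner (Θ k) G))
    (hρ : Tendsto ρ l (𝓝 0)) (hρ_pos : ∀ᶠ i in l, 0 < ρ i)
    (hW : ∀ᶠ i in l, W i ∈ contractions S)
    (hWX : ∀ᶠ i in l, frobInner (W i) (shifted Θ Xbar (δ i)) = nuclearNorm (shifted Θ Xbar (δ i)))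
    (hδα : ∀ᶠ i in l, ∀ k ∈ α, δ i k = 0)
    (hgrad : ∀ᶠ i in l, ∀ k ∉ α, frobInner (W i) (Θ k) = h i k - N i k * δ i k / ρ i) :
    Tendsto W l (𝓝 (U₁ * V₁ᴴ + U₂ * (-Γ) * V₂ᴴ)) := by
  rw [tendsto_iff_ultrafilter]
  intro u hu
  have hu' : (u : Filter ι) ≤ l := hu
  obtain ⟨W₀, hW₀S, hW₀⟩ := isCompact_contractions.ultrafilter_le_nhds (u.map W)
    (le_principal_iff.2 (hu' hW))
  have hW₀' : Tendsto W u (𝓝 W₀) := hW₀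
  rw [← hD.limit_eq_block hW₀S (hN.mono_left hu') (hh.mono_left hu') (hρ.mono_left hu')
    (hu' hρ_pos) hW₀' (hu' hW) (hu' hWX) (hu' hδα) (hu' hgrad)]
  exact hW₀'

/-- For parameters close to their limits, every minimizer has the rank of `Xbar`. -/
lemma eventually_rank_eq (hD : SystemData S T Θ α p Xbar G U₁ U₂ V₁ V₂ s Γ) :
    ∀ᶠ q : (Fin d → ℝ) × (Fin d → ℝ) × ℝ in
      𝓝 p ×ˢ 𝓝 (fun k => frobInner (Θ k) G) ×ˢ 𝓝[>] 0,
      ∀ δ, IsCoordMin Θ α Xbar q.1 q.2.1 q.2.2 δ →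
        (shifted Θ Xbar δ).rank = Fintype.card m := by
  set F : Filter ((Fin d → ℝ) × (Fin d → ℝ) × ℝ) :=
    𝓝 p ×ˢ 𝓝 (fun k => frobInner (Θ k) G) ×ˢ 𝓝[>] 0 with hF
  by_contra hcon
  rw [not_eventually] at hcon
  set bad : Set ((Fin d → ℝ) × (Fin d → ℝ) × ℝ) := {q | ∃ δ,
    IsCoordMin Θ α Xbar q.1 q.2.1 q.2.2 δ ∧ (shifted Θ Xbar δ).rank ≠ Fintype.card m} with hbad
  have hfreq : ∃ᶠ q in F, q ∈ bad := hcon.mono fun q hq => by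
    push Not at hq; exact hq
  -- If the claim failed, F restricted to the bad parameters would be a proper filter, along which
  -- minimizers of the wrong rank can be chosen.
  set l := F ⊓ 𝓟 bad with hl
  have hne : l.NeBot := frequently_mem_iff_neBot.1 hfreq
  have hlF : l ≤ F := inf_le_left
  have hN : Tendsto (fun q : (Fin d → ℝ) × (Fin d → ℝ) × ℝ => q.1) l (𝓝 p) :=
    tendsto_fst.mono_left hlF
  have hh : Tendsto (fun q : (Fin d → ℝ) × (Fin d → ℝ) × ℝ => q.2.1) l
      (𝓝 fun k => frobInner (Θ k) G) := (tendsto_fst.comp tendsto_snd).mono_left hlF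
  have hρ' : Tendsto (fun q : (Fin d → ℝ) × (Fin d → ℝ) × ℝ => q.2.2) l (𝓝[>] 0) :=
    (tendsto_snd.comp tendsto_snd).mono_left hlF
  have hρ := hρ'.mono_right nhdsWithin_le_nhds
  have hρ_pos : ∀ᶠ q in l, 0 < q.2.2 := hρ'.eventually self_mem_nhdsWithin
  have hbl : ∀ᶠ q in l, q ∈ bad := (eventually_principal.2 fun _ h => h).filter_mono inf_le_right
  -- The choice is made for all q so that it gives functions; outside the bad set or for nonpositive
  -- ρ the value (0, 0) carries no content.
  have hex : ∀ q : (Fin d → ℝ) × (Fin d → ℝ) × ℝ, ∃ (δ : Fin d → ℝ)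
      (W : Matrix (Fin n₁) (Fin n₂) 𝕜), q ∈ bad → 0 < q.2.2 →
      (W ∈ contractions S ∧ frobInner W (shifted Θ Xbar δ) = nuclearNorm (shifted Θ Xbar δ) ∧
        (∀ k ∈ α, δ k = 0) ∧
        (∀ k ∉ α, frobInner W (Θ k) = q.2.1 k - q.1 k * δ k / q.2.2) ∧
        (shifted Θ Xbar δ).rank ≠ Fintype.card m) := by
    intro q
    by_cases hq : q ∈ bad ∧ 0 < q.2.2
    · obtain ⟨⟨δ, hδ, hr⟩, hpos⟩ := hq
      obtain ⟨W, hW, hWX, hg⟩ := hδ.exists_certificate hD.normed hD.basis_mem hD.mem hpos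
      exact ⟨δ, W, fun _ _ => ⟨hW, hWX, hδ.1, hg, hr⟩⟩
    · exact ⟨0, 0, fun h1 h2 => absurd ⟨h1, h2⟩ hq⟩
  choose δ W hδW using hex
  have hall : ∀ᶠ q in l, _ := hbl.and hρ_pos |>.mono fun q hq => hδW q hq.1 hq.2
  have hWlim := hD.tendsto_certificate hN hh hρ hρ_pos (hall.mono fun q h => h.1)
    (hall.mono fun q h => h.2.1) (hall.mono fun q h => h.2.2.1) (hall.mono fun q h => h.2.2.2.1)
  have hXlim : Tendsto (fun q => shifted Θ Xbar (δ q)) l (𝓝 Xbar) :=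
    tendsto_shifted (hD.tendsto_coord hN hh hρ hρ_pos hWlim (hall.mono fun q h => h.2.2.1)
      (hall.mono fun q h => h.2.2.2.1))
  have hlow : ∀ᶠ q in l, Fintype.card m ≤ (shifted Θ Xbar (δ q)).rank := by
    have := eventually_card_le_rank hD.left₁ hD.right₁ hD.pos
    rw [← hD.eq] at this
    exact hXlim.eventually this
  have hclose : ∀ᶠ q in l, ‖W q - (U₁ * V₁ᴴ + U₂ * (-Γ) * V₂ᴴ)‖ < 1 - ‖-Γ‖ := by
    have h1 : Tendsto (fun q => ‖W q - (U₁ * V₁ᴴ + U₂ * (-Γ) * V₂ᴴ)‖) l (𝓝 0) :=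
      tendsto_iff_norm_sub_tendsto_zero.1 hWlim
    refine h1.eventually_lt_const ?_
    rw [norm_neg]
    linarith [hD.norm_lt]
  -- One parameter where the certificate is close to B and the rank has not dropped: both rank
  -- inequalities hold there, against badness.
  obtain ⟨q, hq, hlo, hcl⟩ := (hall.and (hlow.and hclose)).exists
  exact hq.2.2.2.2 (le_antisymm
    (rank_le_of_norm_sub_block_lt hD.right₂ hD.left₂ hq.1.2 hq.2.1.ge hcl) hlo)

end SystemData

end Limit

/-! ### Convergence in probability -/

section Probability

variable {Ω : Type*} [MeasurableSpace Ω] {P : Measure Ω}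

/-- `x_m → 0` in probability. -/
def SmallInProb (P : Measure Ω) (x : ℕ → Ω → ℝ) : Prop :=
  ∀ ε : ℝ, 0 < ε → Tendsto (fun m => P {ω | ε ≤ |x m ω|}) atTop (𝓝 0)

lemma tendsto_measure_zero_of_subset {A B : ℕ → Set Ω} (hB : Tendsto (fun m => P (B m)) atTop (𝓝 0))
    (h : ∀ᶠ m in atTop, A m ⊆ B m) : Tendsto (fun m => P (A m)) atTop (𝓝 0) :=
  tendsto_of_tendsto_of_tendsto_of_le_of_le' tendsto_const_nhds hB
    (Eventually.of_forall fun _ => zero_le) (h.mono fun _ hm => measure_mono hm)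

lemma tendsto_measure_union_zero {A B : ℕ → Set Ω} (hA : Tendsto (fun m => P (A m)) atTop (𝓝 0))
    (hB : Tendsto (fun m => P (B m)) atTop (𝓝 0)) :
    Tendsto (fun m => P (A m ∪ B m)) atTop (𝓝 0) := by
  have h := hA.add hB
  rw [add_zero] at h
  exact tendsto_of_tendsto_of_tendsto_of_le_of_le tendsto_const_nhds h (fun _ => zero_le)
    fun _ => measure_union_le _ _

lemma SmallInProb.congr {x y : ℕ → Ω → ℝ} (hx : SmallInProb P x) (h : ∀ m ω, x m ω = y m ω) :
    SmallInProb P y := by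
  have : x = y := funext fun m => funext fun ω => h m ω
  rwa [← this]

lemma SmallInProb.add {x y : ℕ → Ω → ℝ} (hx : SmallInProb P x) (hy : SmallInProb P y) :
    SmallInProb P (fun m ω => x m ω + y m ω) := fun ε hε =>
  tendsto_measure_zero_of_subset
    (tendsto_measure_union_zero (hx (ε / 2) (half_pos hε)) (hy (ε / 2) (half_pos hε)))
    (Eventually.of_forall fun m ω hω => by
      by_contra hcon
      simp only [Set.mem_union, Set.mem_ofPred_eq, not_or, not_le] at hcon hω
      have := abs_add_le (x m ω) (y m ω)
      linarith)

lemma SmallInProb.of_tendsto {x : ℕ → ℝ} (hx : Tendsto x atTop (𝓝 0)) :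
    SmallInProb P (fun m _ => x m) := fun ε hε => by
  refine tendsto_measure_zero_of_subset (B := fun _ => ∅) (by simp) ?_
  have : Tendsto (fun m => |x m|) atTop (𝓝 0) := by simpa using hx.abs
  filter_upwards [this.eventually_lt_const hε] with m hm ω hω
  simp only [Set.mem_ofPred_eq] at hω
  exact absurd hm (not_lt.2 hω)

/-- Off two events of small probability |γ| ≤ |C| + 1 and |x| < ε/(|C| + 1). Using |C| + 1 rather
than C keeps the divisor positive whatever the sign of C. -/
lemma BoundedInProb.mul_small {γ x : ℕ → Ω → ℝ} (hγ : BoundedInProb P γ) (hx : SmallInProb P x) :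
    SmallInProb P (fun m ω => γ m ω * x m ω) := by
  intro ε hε
  rw [ENNReal.tendsto_nhds_zero]
  intro η hη
  obtain ⟨η', hη', hle⟩ : ∃ η' : ℝ, 0 < η' ∧ ENNReal.ofReal η' + ENNReal.ofReal η' ≤ η := by
    rcases eq_or_ne η ⊤ with rfl | htop
    · exact ⟨1, one_pos, le_top⟩
    · refine ⟨η.toReal / 2, half_pos (ENNReal.toReal_pos hη.ne' htop), ?_⟩
      have h0 : 0 ≤ η.toReal / 2 := by positivity
      rw [← ENNReal.ofReal_add h0 h0, add_halves, ENNReal.ofReal_toReal htop]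
  obtain ⟨C, hC⟩ := hγ η' hη'
  have hC' : 0 < |C| + 1 := by positivity
  have hx' := (ENNReal.tendsto_nhds_zero.1 (hx (ε / (|C| + 1)) (by positivity)))
    (ENNReal.ofReal η') (by simpa using hη')
  filter_upwards [hC, hx'] with m h1 h2
  refine le_trans (le_trans (measure_mono ?_) (measure_union_le _ _)) ((add_le_add h1 h2).trans hle)
  intro ω hω
  by_contra hcon
  simp only [Set.mem_union, Set.mem_ofPred_eq, not_or, not_le, not_lt] at hcon hω
  have h3 : |γ m ω| ≤ |C| + 1 := by linarith [hcon.1, le_abs_self C]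
  have h4 := (lt_div_iff₀ hC').1 hcon.2
  rw [abs_mul] at hω
  nlinarith [abs_nonneg (x m ω)]

lemma boundedInProb_const (c : ℝ) : BoundedInProb P (fun _ _ => c) := fun ε _ =>
  ⟨|c|, Eventually.of_forall fun _ => by simp⟩

lemma SmallInProb.const_mul {x : ℕ → Ω → ℝ} (c : ℝ) (hx : SmallInProb P x) :
    SmallInProb P (fun m ω => c * x m ω) :=
  (boundedInProb_const c).mul_small hx

/-- A union bound over the finitely many coordinates, using balls of the sup metric. -/
lemma SmallInProb.tendsto_measure_notMem {d : ℕ} {x : ℕ → Ω → Fin d → ℝ} {a : Fin d → ℝ}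
    (hx : ∀ k, SmallInProb P (fun m ω => x m ω k - a k)) {A : Set (Fin d → ℝ)} (hA : A ∈ 𝓝 a) :
    Tendsto (fun m => P {ω | x m ω ∉ A}) atTop (𝓝 0) := by
  obtain ⟨ε, hε, hball⟩ := Metric.mem_nhds_iff.1 hA
  have hsum : Tendsto (fun m => ∑ k, P {ω | ε ≤ |x m ω k - a k|}) atTop (𝓝 0) := by
    have := tendsto_finsetSum Finset.univ fun k _ => hx k ε hε
    simpa using this
  refine tendsto_of_tendsto_of_tendsto_of_le_of_le tendsto_const_nhds hsum
    (fun _ => zero_le) fun m => ?_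
  refine le_trans (measure_mono ?_) (measure_iUnion_fintype_le P _)
  intro ω hω
  by_contra hcon
  simp only [Set.mem_iUnion, Set.mem_ofPred_eq, not_exists, not_le] at hcon
  exact hω (hball (Metric.mem_ball.2 ((dist_pi_lt_iff hε).2 hcon)))

/-- Chebyshev's inequality for averages, at a scale larger than `m ^ (-1/2)`. -/
lemma smallInProb_average [IsProbabilityMeasure P] {Z : ℕ → Ω → ℝ} {v : ℝ} {ρ : ℕ → ℝ}
    (hZ : ∀ i, MemLp (Z i) 2 P) (hmean : ∀ i, ∫ ω, Z i ω ∂P = 0)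
    (hvar : ∀ i, ∫ ω, Z i ω ^ 2 ∂P ≤ v) (hindep : Pairwise fun i j => IndepFun (Z i) (Z j) P)
    (hρ : ∀ m, 0 < ρ m) (hrate : Tendsto (fun m : ℕ => √(m : ℝ) * ρ m) atTop atTop) :
    SmallInProb P (fun m ω => (1 / (m : ℝ) * ∑ i ∈ Finset.range m, Z i ω) / ρ m) := by
  intro ε hε
  have hlim : Tendsto (fun m : ℕ => ENNReal.ofReal (v / ε ^ 2 / (√(m : ℝ) * ρ m) ^ 2))
      atTop (𝓝 0) := by
    have h1 : Tendsto (fun m : ℕ => (√(m : ℝ) * ρ m) ^ 2) atTop atTop :=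
      (tendsto_pow_atTop two_ne_zero).comp hrate
    have h2 := (tendsto_const_nhds (x := v / ε ^ 2)).div_atTop h1
    simpa using ENNReal.tendsto_ofReal h2
  refine tendsto_of_tendsto_of_tendsto_of_le_of_le' tendsto_const_nhds hlim
    (Eventually.of_forall fun _ => zero_le) ?_
  filter_upwards [eventually_ge_atTop 1] with m hm
  have hm0 : (0 : ℝ) < m := by exact_mod_cast hm
  set S : Ω → ℝ := ∑ i ∈ Finset.range m, Z i with hS
  have hSL : MemLp S 2 P := memLp_finsetSum' _ fun i _ => hZ i
  have hSmean : ∫ ω, S ω ∂P = 0 := by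
    simp only [hS, Finset.sum_apply]
    rw [integral_finsetSum _ fun i _ => (hZ i).integrable (by norm_num)]
    simp [hmean]
  have hSvar : variance S P ≤ m * v := by
    rw [hS, IndepFun.variance_sum (fun i _ => hZ i) fun i _ j _ hij => hindep hij]
    calc ∑ i ∈ Finset.range m, variance (Z i) P ≤ ∑ i ∈ Finset.range m, v := by
          refine Finset.sum_le_sum fun i _ => ?_
          rw [variance_of_integral_eq_zero (hZ i).1.aemeasurable (hmean i)]
          exact hvar i
      _ = m * v := by simp
  -- Chebyshev at the threshold ε m ρ for the sum; with variance at most m v the bound is v / (ε²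
  -- (√m ρ)²).
  have hc : 0 < ε * m * ρ m := by have := hρ m; positivity
  have hch := meas_ge_le_variance_div_sq hSL hc
  rw [hSmean] at hch
  have hset : {ω | ε ≤ |(1 / (m : ℝ) * ∑ i ∈ Finset.range m, Z i ω) / ρ m|} =
      {ω | ε * m * ρ m ≤ |S ω - 0|} := by
    ext ω
    simp only [Set.mem_ofPred_eq, sub_zero, hS, Finset.sum_apply]
    rw [abs_div, abs_mul, abs_of_pos (hρ m), abs_of_pos (by positivity : (0 : ℝ) < 1 / m),
      le_div_iff₀ (hρ m), one_div, ← div_eq_inv_mul, le_div_iff₀ hm0]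
    ring_nf
  rw [hset]
  refine hch.trans (ENNReal.ofReal_le_ofReal ?_)
  have hρm := hρ m
  calc variance S P / (ε * m * ρ m) ^ 2 ≤ m * v / (ε * m * ρ m) ^ 2 := by gcongr
    _ = v / ε ^ 2 / (√(m : ℝ) * ρ m) ^ 2 := by
      rw [mul_pow √(m : ℝ), Real.sq_sqrt hm0.le]
      field_simp

variable {d : ℕ} {p : Fin d → ℝ} {idx : ℕ → Ω → Fin d} {ξ : ℕ → Ω → ℝ}

lemma IsSample.pairwise_indepFun (hs : IsSample P p idx ξ) {φ : Fin d × ℝ → ℝ}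
    (hφ : Measurable φ) :
    Pairwise fun i j => IndepFun (fun ω => φ (idx i ω, ξ i ω)) (fun ω => φ (idx j ω, ξ j ω)) P :=
  fun _ _ hij => (hs.indep_seq.indepFun hij).comp hφ hφ

lemma measurable_ite_fst (k : Fin d) : Measurable fun q : Fin d × ℝ => if q.1 = k then q.2 else 0 :=
  Measurable.ite (measurable_fst (measurableSet_singleton k)) measurable_snd measurable_const

lemma measurable_ite_const (k : Fin d) (c : ℝ) :
    Measurable fun q : Fin d × ℝ => (if q.1 = k then (1 : ℝ) else 0) - c :=
  (Measurable.ite (measurable_fst (measurableSet_singleton k)) measurable_const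
    measurable_const).sub_const c

/-- The averages of the noise over the observations with a given index are small. -/
lemma IsSample.smallInProb_noise [IsProbabilityMeasure P] (hs : IsSample P p idx ξ) {ρ : ℕ → ℝ}
    (hρ : ∀ m, 0 < ρ m) (hrate : Tendsto (fun m : ℕ => √(m : ℝ) * ρ m) atTop atTop) (k : Fin d) :
    SmallInProb P (fun m ω =>
      (1 / (m : ℝ) * ∑ i ∈ Finset.range m, if idx i ω = k then ξ i ω else 0) / ρ m) := by
  have hmeas : ∀ i, Measurable fun ω => if idx i ω = k then ξ i ω else 0 := fun i =>
    (measurable_ite_fst k).comp ((hs.measurable_idx i).prodMk (hs.measurable_noise i))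
  have hL : ∀ i, MemLp (ξ i) 2 P := fun i =>
    (memLp_two_iff_integrable_sq (hs.measurable_noise i).aestronglyMeasurable).2
      (hs.integrable_sq_noise i)
  have hZL : ∀ i, MemLp (fun ω => if idx i ω = k then ξ i ω else 0) 2 P := fun i =>
    (hL i).mono (hmeas i).aestronglyMeasurable
      (Eventually.of_forall fun ω => by by_cases h : idx i ω = k <;> simp [h])
  refine smallInProb_average (v := 1) hZL (fun i => ?_) (fun i => ?_)
    (hs.pairwise_indepFun (measurable_ite_fst k)) hρ hrate
  -- The product of the index indicator with the noise has mean zero because the two are independent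
  -- and the noise is centred.
  · have hind : Measurable fun j : Fin d => if j = k then (1 : ℝ) else 0 := measurable_of_finite _
    have h1 := ((hs.indep_pair i).comp hind measurable_id).integral_fun_mul_eq_mul_integral
      (hind.comp (hs.measurable_idx i)).aestronglyMeasurable
      (measurable_id.comp (hs.measurable_noise i)).aestronglyMeasurable
    have h2 : ∫ ω, (id ∘ ξ i) ω ∂P = 0 := hs.mean_noise i
    rw [h2, mul_zero] at h1
    refine Eq.trans ?_ h1
    refine integral_congr_ae (Eventually.of_forall fun ω => ?_)
    by_cases h : idx i ω = k <;> simp [h]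
  · rw [← hs.variance_noise i]
    refine integral_mono (hZL i).integrable_sq (hs.integrable_sq_noise i) fun ω => ?_
    by_cases h : idx i ω = k <;> simp [h, sq_nonneg]

/-- The empirical frequencies of the indices are consistent. -/
lemma IsSample.smallInProb_freq [IsProbabilityMeasure P] (hs : IsSample P p idx ξ)
    (hp : ∀ k, 0 ≤ p k) (k : Fin d) :
    SmallInProb P (fun m ω =>
      1 / (m : ℝ) * ∑ i ∈ Finset.range m, ((if idx i ω = k then 1 else 0) - p k)) := by
  have hmeas : ∀ i, Measurable fun ω => (if idx i ω = k then (1 : ℝ) else 0) - p k := fun i =>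
    (measurable_ite_const k (p k)).comp ((hs.measurable_idx i).prodMk (hs.measurable_noise i))
  have hbd : ∀ i ω, |(if idx i ω = k then (1 : ℝ) else 0) - p k| ≤ 1 + p k := fun i ω => by
    have := hp k
    by_cases h : idx i ω = k <;> simp only [h, if_true, if_false] <;>
      exact abs_le.2 ⟨by linarith, by linarith⟩
  have hZL : ∀ i, MemLp (fun ω => (if idx i ω = k then (1 : ℝ) else 0) - p k) 2 P := fun i =>
    MemLp.of_bound (hmeas i).aestronglyMeasurable (1 + p k) (Eventually.of_forall (hbd i))
  -- The weak law is the same average estimate with the constant scale 1.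
  have hrate : Tendsto (fun m : ℕ => √(m : ℝ) * 1) atTop atTop := by
    simp only [mul_one]
    exact Real.tendsto_sqrt_atTop.comp tendsto_natCast_atTop_atTop
  have key := smallInProb_average (v := (1 + p k) ^ 2) hZL (fun i => ?_) (fun i => ?_)
    (hs.pairwise_indepFun (measurable_ite_const k (p k))) (fun _ => one_pos) hrate
  · simpa using key
  · have hset : MeasurableSet {ω | idx i ω = k} :=
      hs.measurable_idx i (measurableSet_singleton k)
    have h1 : ∫ ω, (if idx i ω = k then (1 : ℝ) else 0) ∂P = p k := by
      have : (fun ω => if idx i ω = k then (1 : ℝ) else 0) =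
          Set.indicator {ω | idx i ω = k} 1 := by
        ext ω; simp [Set.indicator_apply]
      rw [this, integral_indicator_one hset, measureReal_def, hs.law_idx, ENNReal.toReal_ofReal (hp k)]
    have hint : Integrable (fun ω => if idx i ω = k then (1 : ℝ) else 0) P := by
      have := ((hZL i).integrable (by norm_num)).add (integrable_const (p k))
      refine this.congr (Eventually.of_forall fun ω => ?_)
      simp
    rw [integral_sub hint (integrable_const _), h1]
    simp
  · calc ∫ ω, ((if idx i ω = k then (1 : ℝ) else 0) - p k) ^ 2 ∂P ≤ ∫ ω, (1 + p k) ^ 2 ∂P := by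
          refine integral_mono (hZL i).integrable_sq (integrable_const _) fun ω => ?_
          exact sq_le_sq' (abs_le.1 (hbd i ω)).1 (abs_le.1 (hbd i ω)).2
      _ = (1 + p k) ^ 2 := by simp

end Probability

/-! ### The objective function in coordinates -/

section Objective

variable {𝕜 : Type*} [RCLike 𝕜] {n₁ n₂ d : ℕ}
  {Θ : Fin d → Matrix (Fin n₁) (Fin n₂) 𝕜} {α : Finset (Fin d)}
  {S : Submodule ℝ (Matrix (Fin n₁) (Fin n₂) 𝕜)}

lemma IsONBasis.mem (hΘ : IsONBasis S Θ) (k : Fin d) : Θ k ∈ S := by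
  rw [← hΘ.2]; exact Submodule.subset_span ⟨k, rfl⟩

lemma IsONBasis.frobInner_sum_smul (hΘ : IsONBasis S Θ) (δ : Fin d → ℝ) (k : Fin d) :
    frobInner (Θ k) (∑ l, δ l • Θ l) = δ k := by
  rw [frobInner_sum_right]
  simp [frobInner_smul_right, hΘ.1]

lemma IsONBasis.sum_frobInner_smul (hΘ : IsONBasis S Θ) {X : Matrix (Fin n₁) (Fin n₂) 𝕜}
    (hX : X ∈ S) : ∑ k, frobInner (Θ k) X • Θ k = X := by
  rw [← hΘ.2] at hX
  obtain ⟨c, rfl⟩ := (Submodule.mem_span_range_iff_exists_fun ℝ).1 hX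
  exact Finset.sum_congr rfl fun k _ => by rw [hΘ.frobInner_sum_smul]

lemma IsONBasis.mem_feasibleSet_iff (hΘ : IsONBasis S Θ) {Xbar : Matrix (Fin n₁) (Fin n₂) 𝕜}
    (hXbar : Xbar ∈ S) {X : Matrix (Fin n₁) (Fin n₂) 𝕜} :
    X ∈ feasibleSet S Θ α Xbar ↔ ∃ δ : Fin d → ℝ, (∀ k ∈ α, δ k = 0) ∧ X = shifted Θ Xbar δ := by
  constructor
  · rintro ⟨hXS, hX⟩
    refine ⟨fun k => frobInner (Θ k) (X - Xbar), fun k hk => ?_, ?_⟩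
    · change frobInner (Θ k) (X - Xbar) = 0
      rw [frobInner_sub_right, hX k hk, sub_self]
    · rw [shifted, hΘ.sum_frobInner_smul (S.sub_mem hXS hXbar)]
      abel
  · rintro ⟨δ, hδ, rfl⟩
    refine ⟨S.add_mem hXbar (sum_smul_mem hΘ.mem δ), fun k hk => ?_⟩
    rw [shifted, frobInner_add_right, hΘ.frobInner_sum_smul, hδ k hk, add_zero]

/-- The average of `x` over the observations with index `k`, out of `m` observations. -/
def indexAverage {d : ℕ} (m : ℕ) (idx : ℕ → Fin d) (x : ℕ → ℝ) (k : Fin d) : ℝ :=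
  1 / (m : ℝ) * ∑ i ∈ Finset.range m, if idx i = k then x i else 0

/-- The quadratic coefficients of the coordinate objective. -/
def coordWeight {d : ℕ} (m : ℕ) (idx : ℕ → Fin d) (ρ γ : ℝ) (k : Fin d) : ℝ :=
  indexAverage m idx (fun _ => 1) k + γ * ρ

/-- The linear coefficients of the coordinate objective. -/
def coordShift (Θ : Fin d → Matrix (Fin n₁) (Fin n₂) 𝕜) (m : ℕ) (idx : ℕ → Fin d) (ξ : ℕ → ℝ)
    (ν ρ γ : ℝ) (G X₀ Xbar : Matrix (Fin n₁) (Fin n₂) 𝕜) (k : Fin d) : ℝ :=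
  ν * (indexAverage m idx ξ k / ρ) + frobInner (Θ k) G - γ * frobInner (Θ k) (Xbar - X₀)

/-- Expand the square and group the observations by index; both the cross term and the quadratic
term become diagonal in δ. -/
lemma sum_residual_sq {m : ℕ} (idx : ℕ → Fin d) (ξ : ℕ → ℝ) (ν : ℝ) (δ : Fin d → ℝ) :
    1 / (2 * (m : ℝ)) * ∑ i ∈ Finset.range m, (ν * ξ i - δ (idx i)) ^ 2 =
      1 / (2 * (m : ℝ)) * ∑ i ∈ Finset.range m, (ν * ξ i) ^ 2
        - ∑ k, ν * indexAverage m idx ξ k * δ k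
        + 1 / 2 * ∑ k, indexAverage m idx (fun _ => 1) k * δ k ^ 2 := by
  have h1 : ∑ k, ν * indexAverage m idx ξ k * δ k =
      1 / (m : ℝ) * ∑ i ∈ Finset.range m, ν * ξ i * δ (idx i) := by
    have : ∀ i, ν * ξ i * δ (idx i) = ∑ k, ν * (if idx i = k then ξ i else 0) * δ k := by
      intro i; simp
    simp only [this]
    rw [Finset.sum_comm, Finset.mul_sum]
    refine Finset.sum_congr rfl fun k _ => ?_
    rw [indexAverage, ← Finset.sum_mul, ← Finset.mul_sum]
    ring
  have h2 : ∑ k, indexAverage m idx (fun _ => 1) k * δ k ^ 2 =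
      1 / (m : ℝ) * ∑ i ∈ Finset.range m, δ (idx i) ^ 2 := by
    have : ∀ i, δ (idx i) ^ 2 = ∑ k, (if idx i = k then (1 : ℝ) else 0) * δ k ^ 2 := by
      intro i; simp
    simp only [this]
    rw [Finset.sum_comm, Finset.mul_sum]
    refine Finset.sum_congr rfl fun k _ => ?_
    rw [indexAverage, ← Finset.sum_mul]
    ring
  have h3 : ∑ i ∈ Finset.range m, (ν * ξ i - δ (idx i)) ^ 2 =
      ∑ i ∈ Finset.range m, (ν * ξ i) ^ 2 - 2 * ∑ i ∈ Finset.range m, ν * ξ i * δ (idx i) +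
        ∑ i ∈ Finset.range m, δ (idx i) ^ 2 := by
    rw [Finset.mul_sum, ← Finset.sum_sub_distrib, ← Finset.sum_add_distrib]
    exact Finset.sum_congr rfl fun i _ => by ring
  rw [h1, h2, h3, one_div, one_div, mul_inv]
  ring

/-- Orthonormality makes the proximal term diagonal as well: its square goes into the weights as γρ
and its cross term into the shift. The last summand does not involve δ and so does not affect the
minimizers. -/
lemma IsONBasis.objective_shifted (hΘ : IsONBasis S Θ) {m : ℕ} {idx : ℕ → Fin d}
    {y ξ : ℕ → ℝ} {ν ρ γ : ℝ} {G X₀ Xbar : Matrix (Fin n₁) (Fin n₂) 𝕜}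
    (hy : ∀ i, y i = frobInner (Θ (idx i)) Xbar + ν * ξ i) (hρ : 0 < ρ) (δ : Fin d → ℝ) :
    objective Θ m idx y ρ γ G X₀ (shifted Θ Xbar δ) =
      coordObjective Θ Xbar (coordWeight m idx ρ γ) (coordShift Θ m idx ξ ν ρ γ G X₀ Xbar) ρ δ +
        (1 / (2 * (m : ℝ)) * ∑ i ∈ Finset.range m, (ν * ξ i) ^ 2 +
          ρ * (γ / 2 * frobNorm (Xbar - X₀) ^ 2 - frobInner G Xbar)) := by
  have h1 : ∀ i, y i - frobInner (Θ (idx i)) (shifted Θ Xbar δ) = ν * ξ i - δ (idx i) := by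
    intro i
    rw [hy, shifted, frobInner_add_right, hΘ.frobInner_sum_smul]
    ring
  have h2 : frobInner G (shifted Θ Xbar δ) =
      frobInner G Xbar + ∑ k, frobInner (Θ k) G * δ k := by
    rw [shifted, frobInner_add_right, frobInner_sum_right]
    congr 1
    refine Finset.sum_congr rfl fun k _ => ?_
    rw [frobInner_smul_right, frobInner_comm, mul_comm]
  have h3 : frobNorm (shifted Θ Xbar δ - X₀) ^ 2 = frobNorm (Xbar - X₀) ^ 2 +
      2 * ∑ k, frobInner (Θ k) (Xbar - X₀) * δ k + ∑ k, δ k ^ 2 := by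
    have e : shifted Θ Xbar δ - X₀ = (Xbar - X₀) + ∑ k, δ k • Θ k := by rw [shifted]; abel
    have e1 : frobInner (∑ k, δ k • Θ k) (Xbar - X₀) =
        ∑ k, frobInner (Θ k) (Xbar - X₀) * δ k := by
      rw [frobInner_sum_left]
      exact Finset.sum_congr rfl fun k _ => by rw [frobInner_smul_left, mul_comm]
    have e2 : frobInner (∑ k, δ k • Θ k) (∑ k, δ k • Θ k) = ∑ k, δ k ^ 2 := by
      rw [frobInner_sum_left]
      refine Finset.sum_congr rfl fun k _ => ?_
      rw [frobInner_smul_left, hΘ.frobInner_sum_smul, sq]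
    rw [e, frobNorm_sq, frobNorm_sq, frobInner_add_left, frobInner_add_right, frobInner_add_right,
      frobInner_comm (Xbar - X₀) (∑ k, δ k • Θ k), e1, e2]
    ring
  have h4 : ∑ k, coordWeight m idx ρ γ k * δ k ^ 2 =
      ∑ k, indexAverage m idx (fun _ => 1) k * δ k ^ 2 + γ * ρ * ∑ k, δ k ^ 2 := by
    rw [Finset.mul_sum, ← Finset.sum_add_distrib]
    exact Finset.sum_congr rfl fun k _ => by rw [coordWeight]; ring
  have h5 : ρ * ∑ k, coordShift Θ m idx ξ ν ρ γ G X₀ Xbar k * δ k =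
      ∑ k, ν * indexAverage m idx ξ k * δ k + ρ * ∑ k, frobInner (Θ k) G * δ k -
        ρ * γ * ∑ k, frobInner (Θ k) (Xbar - X₀) * δ k := by
    rw [Finset.mul_sum, Finset.mul_sum, Finset.mul_sum, ← Finset.sum_add_distrib,
      ← Finset.sum_sub_distrib]
    refine Finset.sum_congr rfl fun k _ => ?_
    rw [coordShift]
    field_simp
  unfold objective coordObjective
  simp only [h1]
  rw [sum_residual_sq, h2, h3, h4, h5]
  ring

/-- The optimal solutions of the rank-correction step are given by the minimizers of the coordinate
objective. -/
lemma IsONBasis.isOptimal_iff (hΘ : IsONBasis S Θ) {m : ℕ} {idx : ℕ → Fin d}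
    {y ξ : ℕ → ℝ} {ν ρ γ : ℝ} {G X₀ Xbar X : Matrix (Fin n₁) (Fin n₂) 𝕜} (hXbar : Xbar ∈ S)
    (hy : ∀ i, y i = frobInner (Θ (idx i)) Xbar + ν * ξ i) (hρ : 0 < ρ) :
    IsOptimal S Θ α Xbar m idx y ρ γ G X₀ X ↔
      ∃ δ, IsCoordMin Θ α Xbar (coordWeight m idx ρ γ) (coordShift Θ m idx ξ ν ρ γ G X₀ Xbar) ρ δ ∧
        X = shifted Θ Xbar δ := by
  constructor
  · rintro ⟨hX, hmin⟩
    obtain ⟨δ, hδ, rfl⟩ := (hΘ.mem_feasibleSet_iff hXbar).1 hX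
    refine ⟨δ, ⟨hδ, fun e he => ?_⟩, rfl⟩
    have := hmin _ ((hΘ.mem_feasibleSet_iff hXbar).2 ⟨e, he, rfl⟩)
    rw [hΘ.objective_shifted hy hρ, hΘ.objective_shifted hy hρ] at this
    linarith
  · rintro ⟨δ, ⟨hδ, hmin⟩, rfl⟩
    refine ⟨(hΘ.mem_feasibleSet_iff hXbar).2 ⟨δ, hδ, rfl⟩, fun Z hZ => ?_⟩
    obtain ⟨e, he, rfl⟩ := (hΘ.mem_feasibleSet_iff hXbar).1 hZ
    rw [hΘ.objective_shifted hy hρ, hΘ.objective_shifted hy hρ]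
    linarith [hmin e he]

end Objective

/-! ### The singular value decompositions of the four matrix spaces -/

section Geometry

open scoped Matrix.Norms.L2Operator

variable {𝕜 : Type*} [RCLike 𝕜]

lemma mem_space_hermitian {n : ℕ} {X : Matrix (Fin n) (Fin n) 𝕜} :
    X ∈ (MatrixKind.hermitian n).space 𝕜 ↔ Xᴴ = X := Iff.rfl

/-- In the self-adjoint case, average a norming contraction with its adjoint: the pairing with a
self-adjoint matrix does not change and the norm does not grow. -/
lemma MatrixKind.isNormed {n₁ n₂ : ℕ} (κ : MatrixKind n₁ n₂) : IsNormed (κ.space 𝕜) := by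
  intro Z hZ
  obtain ⟨W, hW, h⟩ := exists_frobInner_eq_nuclearNorm Z
  cases κ with
  | full => exact ⟨W, ⟨Submodule.mem_top, hW⟩, h⟩
  | hermitian =>
    rw [mem_space_hermitian] at hZ
    refine ⟨(1 / 2 : ℝ) • (W + Wᴴ), ⟨?_, ?_⟩, ?_⟩
    · rw [mem_space_hermitian]
      simp [add_comm]
    · rw [norm_real_smul_l2]
      have h1 := norm_add_le W Wᴴ
      rw [Matrix.l2_opNorm_conjTranspose] at h1
      rw [abs_of_pos (by norm_num)]
      linarith
    · have h1 : frobInner Wᴴ Z = frobInner W Z := by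
        conv_lhs => rw [← hZ]
        exact frobInner_conjTranspose W Z
      rw [frobInner_smul_left, frobInner_add_left, h1, h]
      ring

lemma sum_firstCols_add_sum_lastCols {M : Type*} [AddCommMonoid M] {n r : ℕ} (h : r ≤ n)
    (f : Fin n → M) :
    ∑ j : Fin r, f (Fin.castLE h j) +
      ∑ j : Fin (n - r), f ⟨r + j, by have := j.isLt; omega⟩ = ∑ j, f j := by
  have e : r + (n - r) = n := by omega
  rw [← Equiv.sum_comp (finSumFinEquiv.trans (finCongr e)) f, Fintype.sum_sum_type]
  rfl

lemma firstCols_eq_mul {n r : ℕ} (U : Matrix (Fin n) (Fin n) 𝕜) (h : r ≤ n) :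
    firstCols U h = U * firstCols (1 : Matrix (Fin n) (Fin n) 𝕜) h := by
  ext i j
  simp only [firstCols, Matrix.mul_apply, Matrix.submatrix_apply, id, Matrix.one_apply]
  simp

lemma firstCols_mul_add_lastCols_mul {n r : ℕ} (U : Matrix (Fin n) (Fin n) 𝕜) (h : r ≤ n) :
    firstCols U h * (firstCols U h)ᴴ + lastCols U r * (lastCols U r)ᴴ = U * Uᴴ := by
  ext i j
  simp only [Matrix.add_apply, Matrix.mul_apply, firstCols, lastCols, Matrix.conjTranspose_apply,
    Matrix.submatrix_apply, id]
  exact sum_firstCols_add_sum_lastCols h fun k => U i k * star (U j k)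

lemma firstCols_gram {n r : ℕ} {U : Matrix (Fin n) (Fin n) 𝕜} (hU : Uᴴ * U = 1) (h : r ≤ n) :
    (firstCols U h)ᴴ * firstCols U h = 1 := by
  ext i j
  have := congrFun (congrFun hU (Fin.castLE h i)) (Fin.castLE h j)
  simpa [Matrix.mul_apply, firstCols, Matrix.one_apply, Fin.ext_iff] using this

lemma lastCols_gram {n r : ℕ} {U : Matrix (Fin n) (Fin n) 𝕜} (hU : Uᴴ * U = 1) :
    (lastCols U r)ᴴ * lastCols U r = 1 := by
  ext i j
  have := congrFun (congrFun hU ⟨r + i, by have := i.isLt; omega⟩)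
    ⟨r + j, by have := j.isLt; omega⟩
  simpa [Matrix.mul_apply, lastCols, Matrix.one_apply, Fin.ext_iff] using this

lemma firstCols_lastCols_gram {n r : ℕ} {U : Matrix (Fin n) (Fin n) 𝕜} (hU : Uᴴ * U = 1)
    (h : r ≤ n) : (firstCols U h)ᴴ * lastCols U r = 0 := by
  ext i j
  have := congrFun (congrFun hU (Fin.castLE h i)) ⟨r + j, by have := j.isLt; omega⟩
  have hne : (i : ℕ) ≠ r + j := by have := i.isLt; omega
  simpa [Matrix.mul_apply, firstCols, lastCols, Matrix.one_apply, Fin.ext_iff, hne] using this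

/-- D factors through the first r columns of the two identity matrices. Stated entrywise so that it
covers both the rectangular diagonal of singular values and the square diagonal of |λ|. -/
lemma mul_mul_conjTranspose_eq_firstCols {n₁ n₂ r : ℕ} (U : Matrix (Fin n₁) (Fin n₁) 𝕜)
    (V : Matrix (Fin n₂) (Fin n₂) 𝕜) (h₁ : r ≤ n₁) (h₂ : r ≤ n₂) (D : Matrix (Fin n₁) (Fin n₂) 𝕜)
    (s : Fin r → ℝ)
    (hD : ∀ i j, D i j = if h : (i : ℕ) = j ∧ (i : ℕ) < r then (s ⟨i, h.2⟩ : 𝕜) else 0) :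
    U * D * Vᴴ = firstCols U h₁ * diagonal (fun i => (s i : 𝕜)) * (firstCols V h₂)ᴴ := by
  have hD' : D = firstCols (1 : Matrix (Fin n₁) (Fin n₁) 𝕜) h₁ *
      diagonal (fun i => (s i : 𝕜)) * (firstCols (1 : Matrix (Fin n₂) (Fin n₂) 𝕜) h₂)ᴴ := by
    ext i j
    rw [hD, Matrix.mul_apply]
    simp only [Matrix.mul_diagonal, Matrix.conjTranspose_apply, firstCols, Matrix.submatrix_apply,
      id, Matrix.one_apply]
    split_ifs with h
    · rw [Finset.sum_eq_single ⟨i, h.2⟩]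
      · have e1 : i = Fin.castLE h₁ ⟨i, h.2⟩ := by ext; rfl
        have e2 : j = Fin.castLE h₂ ⟨i, h.2⟩ := by ext; exact h.1.symm
        rw [if_pos e1, if_pos e2]
        simp
      · intro k _ hk
        have : i ≠ Fin.castLE h₁ k := fun e => hk (by ext; simp [e])
        rw [if_neg this]
        simp
      · simp
    · symm
      refine Finset.sum_eq_zero fun k _ => ?_
      by_cases e1 : i = Fin.castLE h₁ k
      · have e2 : j ≠ Fin.castLE h₂ k := fun e => h ⟨by simp [e1, e], by simp [e1]⟩
        simp [e2]
      · simp [e1]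
  rw [firstCols_eq_mul U, firstCols_eq_mul V, hD', Matrix.conjTranspose_mul]
  simp only [Matrix.mul_assoc]

/-- If `|l|` is nonincreasing with exactly `r` nonzero entries, then these are the first `r`. -/
lemma ne_zero_iff_lt_of_antitone_abs {n r : ℕ} {l : Fin n → ℝ} (hl : Antitone fun i => |l i|)
    (hr : (Finset.univ.filter fun i => l i ≠ 0).card = r) (i : Fin n) : l i ≠ 0 ↔ (i : ℕ) < r := by
  constructor
  · intro hi
    have hsub : Finset.Iic i ⊆ Finset.univ.filter fun i => l i ≠ 0 := fun j hj => by
      have h1 : |l i| ≤ |l j| := hl (Finset.mem_Iic.1 hj)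
      simp only [Finset.mem_filter, Finset.mem_univ, true_and]
      exact abs_pos.1 ((abs_pos.2 hi).trans_le h1)
    have := Finset.card_le_card hsub
    rw [Fin.card_Iic, hr] at this
    omega
  · intro hi h0
    have hsub : (Finset.univ.filter fun i => l i ≠ 0) ⊆ Finset.Iio i := fun j hj => by
      simp only [Finset.mem_filter, Finset.mem_univ, true_and] at hj
      rw [Finset.mem_Iio]
      by_contra! hij
      have h1 : |l j| ≤ |l i| := hl hij
      rw [h0, abs_zero] at h1
      exact hj (abs_eq_zero.1 (le_antisymm h1 (abs_nonneg _)))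
    have := Finset.card_le_card hsub
    rw [Fin.card_Iio, hr] at this
    omega

lemma rank_unitary_mul_diagonal_mul {n : ℕ} {P : Matrix (Fin n) (Fin n) 𝕜}
    (hP : P ∈ Matrix.unitaryGroup (Fin n) 𝕜) (l : Fin n → ℝ) :
    (P * diagonal (fun i => (l i : 𝕜)) * Pᴴ).rank =
      (Finset.univ.filter fun i => l i ≠ 0).card := by
  have h1 : Pᴴ * P = 1 := Matrix.mem_unitaryGroup_iff'.1 hP
  have h2 : P * Pᴴ = 1 := Matrix.mem_unitaryGroup_iff.1 hP
  have hu1 : IsUnit P.det := (Matrix.isUnit_iff_isUnit_det _).1 ⟨⟨P, Pᴴ, h2, h1⟩, rfl⟩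
  have hu2 : IsUnit Pᴴ.det := (Matrix.isUnit_iff_isUnit_det _).1 ⟨⟨Pᴴ, P, h1, h2⟩, rfl⟩
  rw [Matrix.rank_mul_eq_left_of_isUnit_det _ _ hu2, Matrix.rank_mul_eq_right_of_isUnit_det _ _ hu1,
    Matrix.rank_diagonal, Fintype.card_subtype]
  simp

/-- The singular value decompositions used for the four matrix spaces, in thin form. -/
lemma MatrixKind.exists_thin_of_mem_svdPairs {n₁ n₂ : ℕ} (κ : MatrixKind n₁ n₂)
    {X : Matrix (Fin n₁) (Fin n₂) 𝕜}
    {U : Matrix (Fin n₁) (Fin n₁) 𝕜} {V : Matrix (Fin n₂) (Fin n₂) 𝕜}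
    (hUV : (U, V) ∈ κ.svdPairs X) :
    U ∈ Matrix.unitaryGroup (Fin n₁) 𝕜 ∧ V ∈ Matrix.unitaryGroup (Fin n₂) 𝕜 ∧
      (∃ s : Fin X.rank → ℝ, (∀ i, 0 < s i) ∧
        X = firstCols U X.rank_le_height * diagonal (fun i => (s i : 𝕜)) *
          (firstCols V X.rank_le_width)ᴴ) ∧
      ∀ W ∈ κ.space 𝕜,
        (lastCols U X.rank)ᴴ * W * lastCols V X.rank ∈ (κ.corner X.rank).space 𝕜 := by
  cases κ with
  | full =>
    obtain ⟨hU, hV, hX⟩ := hUV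
    refine ⟨hU, hV, ⟨fun i => sigma X ⟨i, lt_min (i.2.trans_le X.rank_le_height)
      (i.2.trans_le X.rank_le_width)⟩, fun i => (sigma_pos_iff X _).2 i.2, ?_⟩,
      fun W _ => Submodule.mem_top⟩
    refine hX.trans (mul_mul_conjTranspose_eq_firstCols U V _ _ _ _ fun i j => ?_)
    simp only [rectDiag, Matrix.of_apply]
    by_cases hij : (i : ℕ) = j
    · by_cases hi : (i : ℕ) < X.rank
      · rw [dif_pos hij, dif_pos ⟨hij, hi⟩]
      · rw [dif_pos hij, dif_neg fun h => hi h.2]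
        have hi' : (i : ℕ) < min n₁ n₂ := lt_min i.2 (hij ▸ j.2)
        have : sigma X ⟨i, hi'⟩ = 0 :=
          le_antisymm (not_lt.1 fun h => hi ((sigma_pos_iff X ⟨i, hi'⟩).1 h)) (sigma_nonneg _ _)
        rw [this, RCLike.ofReal_zero]
    · rw [dif_neg hij, dif_neg fun h => hij h.1]
  | hermitian =>
    obtain ⟨P, hP, l, hl, hX, hU, hV⟩ := hUV
    simp only at hU hV
    subst hU hV
    set sg : Fin n₁ → 𝕜 := fun i => if l i < 0 then (-1 : 𝕜) else 1 with hsg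
    have hsg2 : ∀ i, sg i * sg i = 1 := fun i => by
      by_cases h : l i < 0 <;> simp [hsg, h]
    have hsgs : ∀ i, star (sg i) = sg i := fun i => by
      by_cases h : l i < 0 <;> simp [hsg, h]
    have hD1 : (diagonal sg)ᴴ = diagonal sg := by
      rw [Matrix.diagonal_conjTranspose]
      congr 1
      exact funext hsgs
    have hD2 : diagonal sg * diagonal sg = 1 := by
      rw [Matrix.diagonal_mul_diagonal, ← Matrix.diagonal_one]
      congr 1
      exact funext hsg2
    have hrank := congrArg Matrix.rank hX
    rw [rank_unitary_mul_diagonal_mul hP] at hrank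
    have hne := ne_zero_iff_lt_of_antitone_abs hl hrank.symm
    have hlabs : ∀ i, ((|l i| : ℝ) : 𝕜) * sg i = l i := fun i => by
      by_cases h : l i < 0
      · simp [hsg, h, abs_of_neg h]
      · simp [hsg, h, abs_of_nonneg (not_lt.1 h)]
    have hXabs : X = U * diagonal (fun i => ((|l i| : ℝ) : 𝕜)) * (U * diagonal sg)ᴴ := by
      rw [Matrix.conjTranspose_mul, hD1]
      conv_lhs => rw [hX]
      simp only [Matrix.mul_assoc]
      rw [← Matrix.mul_assoc (diagonal _) (diagonal sg), Matrix.diagonal_mul_diagonal]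
      simp only [hlabs]
    refine ⟨hP, ?_, ⟨fun i => |l ⟨i, i.2.trans_le X.rank_le_height⟩|,
      fun i => abs_pos.2 ((hne _).2 i.2), ?_⟩, fun W hW => ?_⟩
    · rw [Matrix.mem_unitaryGroup_iff, Matrix.star_eq_conjTranspose, Matrix.conjTranspose_mul, hD1,
        Matrix.mul_assoc, ← Matrix.mul_assoc (diagonal sg), hD2, Matrix.one_mul]
      exact Matrix.mem_unitaryGroup_iff.1 hP
    · refine hXabs.trans (mul_mul_conjTranspose_eq_firstCols _ _ _ _ _ _ fun i j => ?_)
      by_cases hij : i = j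
      · subst hij
        rw [Matrix.diagonal_apply_eq]
        by_cases hi : (i : ℕ) < X.rank
        · rw [dif_pos ⟨rfl, hi⟩]
        · rw [dif_neg fun h => hi h.2, not_not.1 fun h => hi ((hne i).1 h)]
          simp
      · rw [Matrix.diagonal_apply_ne _ hij, dif_neg fun h => hij (Fin.ext h.1)]
    -- The eigenvalues beyond the rank vanish and their sign is +1 by convention, so V₂ = U₂ and the
    -- corner U₂ᴴWU₂ of a self-adjoint W is self-adjoint.
    · have hlast : lastCols (U * diagonal sg) X.rank = lastCols U X.rank := by
        ext i j
        have h0 : l ⟨X.rank + j, by have := j.isLt; omega⟩ = 0 :=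
          not_not.1 fun h => by have := (hne _).1 h; simp at this
        simp [lastCols, hsg, h0]
      rw [hlast]
      rw [mem_space_hermitian] at hW
      change _ ∈ (MatrixKind.hermitian (n₁ - X.rank)).space 𝕜
      rw [mem_space_hermitian]
      simp [Matrix.conjTranspose_mul, hW, Matrix.mul_assoc]

/-- The hypotheses on the linear system provide the data of the limit problem. -/
lemma systemData_of_mem_svdPairs {n₁ n₂ d : ℕ} (κ : MatrixKind n₁ n₂)
    {Θ : Fin d → Matrix (Fin n₁) (Fin n₂) 𝕜} (hΘ : IsONBasis (κ.space 𝕜) Θ)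
    {Xbar G : Matrix (Fin n₁) (Fin n₂) 𝕜} (hXbar : Xbar ∈ κ.space 𝕜)
    {α : Finset (Fin d)} {p : Fin d → ℝ} (hp : ∀ k ∉ α, 0 < p k)
    {U : Matrix (Fin n₁) (Fin n₁) 𝕜} {V : Matrix (Fin n₂) (Fin n₂) 𝕜}
    (hUV : (U, V) ∈ κ.svdPairs Xbar)
    {Γ : Matrix (Fin (n₁ - Xbar.rank)) (Fin (n₂ - Xbar.rank)) 𝕜}
    (hsol : SolvesSystem Θ α p Xbar G U V Γ)
    (huniq : ∀ Γ' ∈ (κ.corner Xbar.rank).space 𝕜, SolvesSystem Θ α p Xbar G U V Γ' → Γ' = Γ)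
    (hnorm : specNorm Γ < 1) :
    ∃ s : Fin Xbar.rank → ℝ, SystemData (κ.space 𝕜) ((κ.corner Xbar.rank).space 𝕜) Θ α p Xbar G
      (firstCols U Xbar.rank_le_height) (lastCols U Xbar.rank)
      (firstCols V Xbar.rank_le_width) (lastCols V Xbar.rank) s Γ := by
  obtain ⟨hU, hV, ⟨s, hs, hX⟩, hcorner⟩ := κ.exists_thin_of_mem_svdPairs hUV
  have hU1 : Uᴴ * U = 1 := Matrix.mem_unitaryGroup_iff'.1 hU
  have hU2 : U * Uᴴ = 1 := Matrix.mem_unitaryGroup_iff.1 hU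
  have hV1 : Vᴴ * V = 1 := Matrix.mem_unitaryGroup_iff'.1 hV
  have hV2 : V * Vᴴ = 1 := Matrix.mem_unitaryGroup_iff.1 hV
  exact ⟨s,
    { normed := κ.isNormed
      basis_mem := hΘ.mem
      mem := hXbar
      prob_pos := hp
      left₁ := firstCols_gram hU1 _
      left₂ := lastCols_gram hU1
      left₁₂ := firstCols_lastCols_gram hU1 _
      left_add := (firstCols_mul_add_lastCols_mul U _).trans hU2
      right₁ := firstCols_gram hV1 _
      right₂ := lastCols_gram hV1
      right_add := (firstCols_mul_add_lastCols_mul V _).trans hV2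
      pos := hs
      eq := hX
      corner_mem := hcorner
      solves := hsol
      unique := huniq
      norm_lt := hnorm }⟩

end Geometry

/-! ### Rank consistency -/

section Consistency

variable {𝕜 : Type*} [RCLike 𝕜] {n₁ n₂ d : ℕ} {Ω : Type*} [MeasurableSpace Ω] {P : Measure Ω}

/-- The continuous mapping theorem at a constant limit. The filter of Frobenius neighbourhoods
intersected with S turns continuity within S into a Frobenius radius on which the coefficient moves
by less than ε. -/
lemma TendstoInProb.smallInProb_frobInner_sub {S : Set (Matrix (Fin n₁) (Fin n₂) 𝕜)}
    {F : Matrix (Fin n₁) (Fin n₂) 𝕜 → Matrix (Fin n₁) (Fin n₂) 𝕜}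
    {X : ℕ → Ω → Matrix (Fin n₁) (Fin n₂) 𝕜} {X₀ : Matrix (Fin n₁) (Fin n₂) 𝕜}
    (hF : ContinuousWithinAt F S X₀) (hXS : ∀ m ω, X m ω ∈ S) (hX : TendstoInProb P X X₀)
    (Y : Matrix (Fin n₁) (Fin n₂) 𝕜) :
    SmallInProb P (fun m ω => frobInner Y (F (X m ω)) - frobInner Y (F X₀)) := by
  intro ε hε
  set l : Filter (Matrix (Fin n₁) (Fin n₂) 𝕜) :=
    comap (fun Z => frobNorm (Z - X₀)) (𝓝 0) ⊓ 𝓟 S with hl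
  have h1 : Tendsto id l (𝓝 X₀) :=
    tendsto_nhds_of_frobNorm (tendsto_comap.mono_left inf_le_left)
  have h2 : Tendsto F l (𝓝 (F X₀)) :=
    hF.tendsto.comp (tendsto_nhdsWithin_iff.2 ⟨h1, mem_inf_of_right (mem_principal_self S)⟩)
  have h3 : ∀ᶠ Z in l, |frobInner Y (F Z) - frobInner Y (F X₀)| < ε := by
    have := tendsto_frobInner (tendsto_const_nhds (x := Y)) h2
    exact (Metric.tendsto_nhds.1 this) ε hε
  rw [hl, eventually_inf_principal] at h3
  obtain ⟨A, hA, hAsub⟩ := mem_comap.1 h3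
  obtain ⟨η, hη, hball⟩ := Metric.mem_nhds_iff.1 hA
  refine tendsto_measure_zero_of_subset (hX η hη) (Eventually.of_forall fun m ω hω => ?_)
  by_contra hcon
  simp only [Set.mem_ofPred_eq, not_le] at hcon hω
  have hmem : X m ω ∈ (fun Z => frobNorm (Z - X₀)) ⁻¹' A := hball (by
    rw [Metric.mem_ball, Real.dist_eq, sub_zero, abs_of_nonneg (frobNorm_nonneg _)]
    exact hcon)
  exact absurd (hAsub hmem (hXS m ω)) (not_lt.2 hω)

lemma IsSample.smallInProb_coordWeight [IsProbabilityMeasure P] {p : Fin d → ℝ}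
    {idx : ℕ → Ω → Fin d} {ξ : ℕ → Ω → ℝ} (hs : IsSample P p idx ξ) (hp : ∀ k, 0 ≤ p k)
    {ρ : ℕ → ℝ} (hρ : Tendsto ρ atTop (𝓝 0)) {γ : ℕ → Ω → ℝ} (hγ : BoundedInProb P γ) (k : Fin d) :
    SmallInProb P (fun m ω => coordWeight m (fun i => idx i ω) (ρ m) (γ m ω) k - p k) := by
  have h1 := (hs.smallInProb_freq hp k).add (hγ.mul_small (SmallInProb.of_tendsto hρ))
  intro ε hε
  refine tendsto_measure_zero_of_subset (h1 ε hε) ?_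
  -- The average of the constant p_k equals p_k only for m ≥ 1.
  filter_upwards [eventually_ge_atTop 1] with m hm ω hω
  have hm0 : (m : ℝ) ≠ 0 := by positivity
  have e : coordWeight m (fun i => idx i ω) (ρ m) (γ m ω) k - p k =
      1 / (m : ℝ) * ∑ i ∈ Finset.range m, ((if idx i ω = k then 1 else 0) - p k) +
        γ m ω * ρ m := by
    rw [coordWeight, indexAverage, Finset.sum_sub_distrib, Finset.sum_const, Finset.card_range,
      nsmul_eq_mul]
    field_simp
    ring
  simp only [Set.mem_ofPred_eq] at hω ⊢
  rwa [← e]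

/-- Three sources of error: noise of order m^(-1/2) against ρ, the continuity of F at the limit, and
a bounded γ times the vanishing error of the initial estimator. -/
lemma IsSample.smallInProb_coordShift [IsProbabilityMeasure P] {p : Fin d → ℝ}
    {idx : ℕ → Ω → Fin d} {ξ : ℕ → Ω → ℝ} (hs : IsSample P p idx ξ)
    {Θ : Fin d → Matrix (Fin n₁) (Fin n₂) 𝕜} {ν : ℝ}
    {ρ : ℕ → ℝ} (hρ_pos : ∀ m, 0 < ρ m)
    (hρ_rate : Tendsto (fun m : ℕ => √(m : ℝ) * ρ m) atTop atTop)
    {γ : ℕ → Ω → ℝ} (hγ : BoundedInProb P γ) {S : Set (Matrix (Fin n₁) (Fin n₂) 𝕜)}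
    {F : Matrix (Fin n₁) (Fin n₂) 𝕜 → Matrix (Fin n₁) (Fin n₂) 𝕜}
    {X : ℕ → Ω → Matrix (Fin n₁) (Fin n₂) 𝕜} {X₀ : Matrix (Fin n₁) (Fin n₂) 𝕜}
    (hF : ContinuousWithinAt F S X₀) (hXS : ∀ m ω, X m ω ∈ S) (hX : TendstoInProb P X X₀)
    (k : Fin d) :
    SmallInProb P (fun m ω => coordShift Θ m (fun i => idx i ω) (fun i => ξ i ω) ν (ρ m) (γ m ω)
      (F (X m ω)) (X m ω) X₀ k - frobInner (Θ k) (F X₀)) := by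
  have h1 := (hs.smallInProb_noise hρ_pos hρ_rate k).const_mul ν
  have h2 := hX.smallInProb_frobInner_sub hF hXS (Θ k)
  have h3 := hγ.mul_small (hX.smallInProb_frobInner_sub (F := id) continuousWithinAt_id hXS (Θ k))
  refine ((h1.add h2).add h3).congr fun m ω => ?_
  rw [coordShift, indexAverage, frobInner_sub_right]
  simp only [id]
  ring

end Consistency

end RankCorrection

end

/-! ### The rank consistency theorem. -/

theorem theorem4p2 {𝕜 : Type*} [RCLike 𝕜] {n₁ n₂ d : ℕ}
    -- the matrix space, an orthonormal basis of it, and the matrix to be recovered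
    (κ : RankCorrection.MatrixKind n₁ n₂)
    (Θ : Fin d → Matrix (Fin n₁) (Fin n₂) 𝕜)
    (hΘ : RankCorrection.IsONBasis (κ.space 𝕜) Θ)
    (Xbar : Matrix (Fin n₁) (Fin n₂) 𝕜) (hXbar : Xbar ∈ κ.space 𝕜) (hrank : 1 ≤ Xbar.rank)
    -- the fixed indices, the sampling distribution, and the noisy observations
    (α : Finset (Fin d)) (p : Fin d → ℝ) (hp : RankCorrection.IsSamplingDistribution α p)
    {Ω : Type*} [MeasurableSpace Ω] (P : Measure Ω) [IsProbabilityMeasure P]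
    (idx : ℕ → Ω → Fin d) (ξ : ℕ → Ω → ℝ) (hsample : RankCorrection.IsSample P p idx ξ)
    (ν : ℝ) (hν : 0 < ν)
    (y : ℕ → Ω → ℝ)
    (hy : ∀ i ω, y i ω = RankCorrection.frobInner (Θ (idx i ω)) Xbar + ν * ξ i ω)
    -- the spectral operator, continuous at `Xbar`
    (f : (Fin (min n₁ n₂) → ℝ) → (Fin (min n₁ n₂) → ℝ)) (hf : RankCorrection.IsSymmetricFun f)
    (hF : ContinuousWithinAt
      (RankCorrection.spectralOperator f : Matrix (Fin n₁) (Fin n₂) 𝕜 → _) (κ.space 𝕜) Xbar)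
    -- the initial estimator, consistent in probability
    (Xtilde : ℕ → Ω → Matrix (Fin n₁) (Fin n₂) 𝕜)
    (hXtilde_meas : ∀ m, RankCorrection.IsRandomMatrix (Xtilde m))
    (hXtilde_mem : ∀ m ω, Xtilde m ω ∈ κ.space 𝕜)
    (hXtilde : RankCorrection.TendstoInProb P Xtilde Xbar)
    -- the regularization parameters
    (ρ : ℕ → ℝ) (hρ_pos : ∀ m, 0 < ρ m) (hρ : Tendsto ρ atTop (𝓝 0))
    (hρ_rate : Tendsto (fun m : ℕ => √(m : ℝ) * ρ m) atTop atTop)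
    (γ : ℕ → Ω → ℝ) (hγ_meas : ∀ m, Measurable (γ m)) (hγ_nonneg : ∀ m ω, 0 ≤ γ m ω)
    (hγ : RankCorrection.BoundedInProb P γ)
    -- the estimator: an optimal solution of the rank-correction step, whenever there is one
    (Xhat : ℕ → Ω → Matrix (Fin n₁) (Fin n₂) 𝕜)
    (hXhat_meas : ∀ m, RankCorrection.IsRandomMatrix (Xhat m))
    (hXhat : ∀ m, ∀ᵐ ω ∂P,
      (∃ X, RankCorrection.IsOptimal (κ.space 𝕜) Θ α Xbar m (fun i => idx i ω) (fun i => y i ω)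
        (ρ m) (γ m ω) (RankCorrection.spectralOperator f (Xtilde m ω)) (Xtilde m ω) X) →
      RankCorrection.IsOptimal (κ.space 𝕜) Θ α Xbar m (fun i => idx i ω) (fun i => y i ω)
        (ρ m) (γ m ω) (RankCorrection.spectralOperator f (Xtilde m ω)) (Xtilde m ω) (Xhat m ω))
    -- the linear system has a unique solution, of spectral norm less than one
    (U : Matrix (Fin n₁) (Fin n₁) 𝕜) (V : Matrix (Fin n₂) (Fin n₂) 𝕜)
    (hUV : (U, V) ∈ κ.svdPairs Xbar)
    (Γhat : Matrix (Fin (n₁ - Xbar.rank)) (Fin (n₂ - Xbar.rank)) 𝕜)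
    (hΓ_mem : Γhat ∈ (κ.corner Xbar.rank).space 𝕜)
    (hΓ_sol : RankCorrection.SolvesSystem Θ α p Xbar
      (RankCorrection.spectralOperator f Xbar) U V Γhat)
    (hΓ_unique : ∀ Γ ∈ (κ.corner Xbar.rank).space 𝕜,
      RankCorrection.SolvesSystem Θ α p Xbar (RankCorrection.spectralOperator f Xbar) U V Γ →
        Γ = Γhat)
    (hΓ_norm : RankCorrection.specNorm Γhat < 1) :
    RankCorrection.RankConsistent P Xhat Xbar := by
  have hp0 : ∀ k, 0 ≤ p k := fun k => by
    by_cases hk : k ∈ α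
    · exact (hp.1 k hk).ge
    · exact (hp.2.1 k hk).le
  obtain ⟨s, hD⟩ := RankCorrection.systemData_of_mem_svdPairs κ hΘ hXbar hp.2.1 hUV hΓ_sol
    hΓ_unique hΓ_norm
  -- Positive weights off α guarantee that a minimizer exists, which is what makes `hXhat`
  -- effective.
  have hpos : ∀ᶠ N in 𝓝 p, ∀ k ∉ α, 0 < N k :=
    eventually_all.2 fun k => by
      by_cases hk : k ∈ α
      · exact Eventually.of_forall fun _ h => absurd hk h
      · exact ((continuous_apply k).tendsto p).eventually_const_lt (hp.2.1 k hk) |>.mono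
          fun _ h _ => h
  obtain ⟨A, hA, B, hB, hAB⟩ := mem_prod_iff.1 hD.eventually_rank_eq
  obtain ⟨B, hB, C, hC, hBC⟩ := mem_prod_iff.1 hB
  have hN := RankCorrection.SmallInProb.tendsto_measure_notMem
    (hsample.smallInProb_coordWeight hp0 hρ hγ) (inter_mem hA hpos)
  have hh := RankCorrection.SmallInProb.tendsto_measure_notMem
    (hsample.smallInProb_coordShift (Θ := Θ) (ν := ν) hρ_pos hρ_rate hγ hF hXtilde_mem hXtilde) hB
  have hbad := RankCorrection.tendsto_measure_union_zero hN hh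
  have hρC : ∀ᶠ m in atTop, ρ m ∈ C :=
    (tendsto_nhdsWithin_iff.2 ⟨hρ, Eventually.of_forall hρ_pos⟩).eventually hC
  -- Almost surely, once ρ m is in C, the rank can differ from that of Xbar only if the weights or
  -- the shifts leave their neighbourhoods.
  have hne : Tendsto (fun m => P {ω | (Xhat m ω).rank = Xbar.rank}ᶜ) atTop (𝓝 0) := by
    refine tendsto_of_tendsto_of_tendsto_of_le_of_le' tendsto_const_nhds hbad
      (Eventually.of_forall fun _ => zero_le) ?_
    filter_upwards [hρC] with m hm
    refine measure_mono_ae ?_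
    filter_upwards [hXhat m] with ω hω hrk
    by_contra hcon
    obtain ⟨hcN, hch⟩ := not_or.1 hcon
    have hcN := not_not.1 hcN
    have hch := not_not.1 hch
    obtain ⟨δ, hδ⟩ := RankCorrection.exists_isCoordMin (Θ := Θ) (Xbar := Xbar)
      (h := RankCorrection.coordShift Θ m (fun i => idx i ω) (fun i => ξ i ω) ν (ρ m) (γ m ω)
        (RankCorrection.spectralOperator f (Xtilde m ω)) (Xtilde m ω) Xbar) hcN.2 (hρ_pos m)
    obtain ⟨e, he, hXe⟩ := (hΘ.isOptimal_iff hXbar (fun i => hy i ω) (hρ_pos m)).1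
      (hω ⟨_, (hΘ.isOptimal_iff hXbar (fun i => hy i ω) (hρ_pos m)).2 ⟨δ, hδ, rfl⟩⟩)
    refine hrk ?_
    change (Xhat m ω).rank = Xbar.rank
    rw [hXe]
    have := hAB (Set.mk_mem_prod hcN.1 (hBC (Set.mk_mem_prod hch hm))) e he
    rwa [Fintype.card_fin] at this
  have hlow : Tendsto (fun m => 1 - P {ω | (Xhat m ω).rank = Xbar.rank}ᶜ) atTop (𝓝 1) := by
    have := ENNReal.Tendsto.sub (tendsto_const_nhds (x := (1 : ENNReal))) hne
      (Or.inl ENNReal.one_ne_top)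
    rwa [tsub_zero] at this
  refine tendsto_of_tendsto_of_tendsto_of_le_of_le hlow tendsto_const_nhds (fun m => ?_)
    fun m => prob_le_one
  -- Subadditivity applied to the event and its complement gives 1 - P(Aᶜ) ≤ P(A) without any
  -- measurability of the rank event.
  rw [tsub_le_iff_right, ← measure_univ (μ := P),
    ← Set.union_compl_self {ω | (Xhat m ω).rank = Xbar.rank}]
  exact measure_union_le _ _
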